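/- **Setting.** Let $\mathcal X,\mathcal Y$ be finite sets and let $P_{XY}$ be a pmf on $\mathcal X\times\mathcal Y$. Logarithms are natural; $H(X)$, $H(Y)$, $H(XY)$, $H(X|Y)$, $H(Y|X)$ are the usual entropies. Put $$\mathrm V(XY)=\sum_{x,y}P_{XY}(x,y)\bigl(-\log P_{XY}(x,y)-H(XY)\bigr)^2,\qquad \mathrm V(X|Y)=\sum_{x,y}P_{XY}(x,y)\bigl(-\log P_{X|Y}(x|y)-H(X|Y)\bigr)^2,$$ define $\mathrm V(Y|X)$ symmetrically, and assume that all three are positive. Let $n,T\ge 1$ be integers. Source block pairs $(\mathbf X_k,\mathbf Y_k)\in\mathcal X^n\times\mathcal Y^n$, $k=1,2,\dots$, are generated, all symbol pairs being i.i.d. with law $P_{XY}$. An $(n,N_1,N_2,T,\varepsilon_n)$-code for streaming Slepian-Wolf coding consists of a random variable $U$ (common randomness, independent of the source and available to all encoders and decoders), encoders $f_k,g_k$ giving $M_{1,k}=f_k(U,\mathbf X_1,\dots,\mathbf X_k)\in\{1,\dots,N_1\}$ and $M_{2,k}=g_k(U,\mathbf Y_1,\dots,\mathbf Y_k)\in\{1,\dots,N_2\}$,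 and decoders giving $(\hat{\mathbf X}_k,\hat{\mathbf Y}_k)=\phi_k\bigl(U,(M_{1,j},M_{2,j})_{j=1}^{k+T-1}\bigr)\in\mathcal X^n\times\mathcal Y^n$, for all $k\ge 1$, such that $$\sup_{k\ge1}\Pr\bigl((\hat{\mathbf X}_k,\hat{\mathbf Y}_k)\ne(\mathbf X_k,\mathbf Y_k)\bigr)\le\varepsilon_n .$$ Let $(\xi_n)_{n\ge1}$ be any positive sequence with $\xi_n\to0$ and $\frac{\log n}{n\xi_n^2}\to0$, and let $R_X^*,R_Y^*\in\mathbb R$ and $\boldsymbol\theta=(\theta_1,\theta_2)\in\mathbb R^2$. A number $\nu$ is achievable if there is a sequence of $(n,N_1,N_2,T,\varepsilon_n)$-codes ($N_1,N_2$ depending on $n$) with $$\limsup_{n\to\infty}\frac{\log N_1-nR_X^*}{n\xi_n}\le\theta_1,\qquad \limsup_{n\to\infty}\frac{\log N_2-nR_Y^*}{n\xi_n}\le\theta_2,\qquad \liminf_{n\to\infty}-\frac{\log\varepsilon_n}{n\xi_n^2}\ge\nu ,$$ and the moderate deviations constant $\nu^*(R_X^*,R_Y^*,\boldsymbol\theta,T)\in[-\infty,\infty]$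 is the supremum of all achievable $\nu$. **Theorem.** 1. Case (i): if $R_X^*=H(X|Y)$, $R_Y^*>H(Y)$ and $\theta_1>0$, then $$\nu^*(R_X^*,R_Y^*,\boldsymbol\theta,T)\ge\frac{T\theta_1^2}{2\mathrm V(X|Y)}.$$ 2. Case (ii): if $R_X^*=H(X|Y)$, $R_Y^*=H(Y)$, $X$ and $Y$ are not independent (that is, $H(Y|X)<H(Y)$), $\theta_1>0$ and $\theta_2>-\theta_1$, then $$\nu^*(R_X^*,R_Y^*,\boldsymbol\theta,T)\ge T\min\left\{\inf_{\gamma\in[0,1]}\frac{(\theta_1+(1-\gamma)\theta_2)^2}{2\bigl(\gamma\mathrm V(X|Y)+(1-\gamma)\mathrm V(XY)\bigr)},\ \frac{(\theta_1+\theta_2)^2}{2\mathrm V(XY)}\right\}.$$ 3. Case (iii): if $R_X^*+R_Y^*=H(XY)$, $H(X|Y)<R_X^*<H(X)$, $H(Y|X)<R_Y^*<H(Y)$ and $\theta_1+\theta_2>0$, then $$\nu^*(R_X^*,R_Y^*,\boldsymbol\theta,T)\ge\frac{T(\theta_1+\theta_2)^2}{2\mathrm V(XY)}.$$ -/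

import Mathlib

open MeasureTheory Filter

namespace StreamingSW

noncomputable section

/-! ### Information quantities (natural logarithms) -/

/-- Shannon entropy `H(p)` of a pmf on a finite set. -/
def entropy {α : Type*} [Fintype α] (p : PMF α) : ℝ :=
  ∑ a, (p a).toReal * (-Real.log (p a).toReal)

/-- The information density `-log P_{X|Y}(x|y)` at `z = (x, y)`, with
`P_{X|Y}(x|y) = P_{XY}(x,y) / P_Y(y)`. It is only used weighted by `P_{XY}(x,y)`. -/
def condInfo {α β : Type*} (P : PMF (α × β)) (z : α × β) : ℝ :=
  -Real.log ((P z).toReal / (P.map Prod.snd z.2).toReal)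

/-- Conditional entropy `H(X|Y)` of the first coordinate given the second one. -/
def condEntropy {α β : Type*} [Fintype α] [Fintype β] (P : PMF (α × β)) : ℝ :=
  ∑ z, (P z).toReal * condInfo P z

/-- The dispersion (varentropy) `V(p)` of a pmf on a finite set. -/
def dispersion {α : Type*} [Fintype α] (p : PMF α) : ℝ :=
  ∑ a, (p a).toReal * (-Real.log (p a).toReal - entropy p) ^ 2

/-- Conditional dispersion `V(P_{X|Y}|P_Y)` of the first coordinate given the second one. -/
def condDispersion {α β : Type*} [Fintype α] [Fintype β] (P : PMF (α × β)) : ℝ :=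
  ∑ z, (P z).toReal * (condInfo P z - condEntropy P) ^ 2

/-- The joint pmf with the two coordinates interchanged, `P_{YX}`; thus
`condEntropy (swap P)` is `H(Y|X)` and `condDispersion (swap P)` is `V(P_{Y|X}|P_X)`. -/
def swap {α β : Type*} (P : PMF (α × β)) : PMF (β × α) := P.map Prod.swap

/-! ### The source and streaming codes -/

/-- The law of the sequence of source block pairs: block `k`, for `k = 0, 1, 2, …`, is a vector
of `n` symbol pairs, and all symbol pairs are i.i.d. with law `P`. -/
def sourceLaw {𝒳 𝒴 : Type*} [MeasurableSpace 𝒳] [MeasurableSpace 𝒴] (P : PMF (𝒳 × 𝒴)) (n : ℕ) :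
    Measure (ℕ → Fin n → 𝒳 × 𝒴) :=
  Measure.infinitePi fun _ : ℕ => Measure.pi fun _ : Fin n => P.toMeasure

/-- Encoders and decoders of a streaming Slepian-Wolf code with blocklength `n`, codebook sizes
`N₁`, `N₂` and block delay `T`, with common randomness `u : Rnd` shared by all of them.
Blocks are numbered from `0`: encoder `k` sees blocks `0, …, k` and decoder `k`, which estimates
block pair `k`, sees the codewords numbered `0, …, k + T - 1`. -/
structure Code (𝒳 𝒴 : Type*) (n N₁ N₂ T : ℕ) where
  /-- the alphabet of the common randomness -/
  Rnd : Type
  /-- its σ-algebra -/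
  mRnd : MeasurableSpace Rnd
  /-- the law of the common randomness -/
  law : Measure Rnd
  isProb : IsProbabilityMeasure law
  /-- encoders of the first source -/
  f : (k : ℕ) → Rnd → (Fin (k + 1) → Fin n → 𝒳) → Fin N₁
  /-- encoders of the second source -/
  g : (k : ℕ) → Rnd → (Fin (k + 1) → Fin n → 𝒴) → Fin N₂
  /-- decoders -/
  φ : (k : ℕ) → Rnd → (Fin (k + T) → Fin N₁) → (Fin (k + T) → Fin N₂) →
    (Fin n → 𝒳) × (Fin n → 𝒴)
  measurable_f : ∀ k x i, MeasurableSet {u | f k u x = i}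
  measurable_g : ∀ k y i, MeasurableSet {u | g k u y = i}
  measurable_φ : ∀ k m₁ m₂ b, MeasurableSet {u | φ k u m₁ m₂ = b}

namespace Code

variable {𝒳 𝒴 : Type*} {n N₁ N₂ T : ℕ}

/-- The estimate of block pair `k` when the common randomness is `u` and the source is `s`. -/
def estimate (C : Code 𝒳 𝒴 n N₁ N₂ T) (k : ℕ) (u : C.Rnd) (s : ℕ → Fin n → 𝒳 × 𝒴) :
    (Fin n → 𝒳) × (Fin n → 𝒴) :=
  C.φ k u
    (fun j => C.f j u fun i t => (s i t).1)
    (fun j => C.g j u fun i t => (s i t).2)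

/-- The probability, over the common randomness and the independent source, that block pair `k`
is decoded incorrectly. -/
def errorProb [MeasurableSpace 𝒳] [MeasurableSpace 𝒴] (C : Code 𝒳 𝒴 n N₁ N₂ T)
    (P : PMF (𝒳 × 𝒴)) (k : ℕ) : ℝ :=
  letI := C.mRnd
  (C.law.prod (sourceLaw P n)).real
    {w | C.estimate k w.1 w.2 ≠ (fun t => (w.2 k t).1, fun t => (w.2 k t).2)}

end Code

/-! ### The moderate deviations constant -/

/-- `ν` is an achievable moderate deviations constant for the source `P` and the backoff sequence
`ξ`, at the rate pair `(RX, RY)`, in the direction `θ` and with block delay `T`: there are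
`(n, N₁, N₂, T, ε)`-codes, one for each blocklength `n ≥ 1`, with
`limsup (log N₁ - n RX) / (n ξ) ≤ θ₁`, `limsup (log N₂ - n RY) / (n ξ) ≤ θ₂` and
`liminf -log ε / (n ξ²) ≥ ν`. Limits are taken in the extended reals. The bound `ε` on the error
probabilities is positive so that its logarithm is meaningful. -/
def Achievable {𝒳 𝒴 : Type*} [MeasurableSpace 𝒳] [MeasurableSpace 𝒴] (P : PMF (𝒳 × 𝒴))
    (ξ : ℕ → ℝ) (RX RY : ℝ) (θ : ℝ × ℝ) (T : ℕ) (ν : ℝ) : Prop :=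
  ∃ (N₁ N₂ : ℕ → ℕ) (ε : ℕ → ℝ),
    (∀ n, 1 ≤ n → 0 < ε n ∧
      ∃ C : Code 𝒳 𝒴 n (N₁ n) (N₂ n) T, ∀ k, C.errorProb P k ≤ ε n) ∧
    limsup (fun n : ℕ => (((Real.log (N₁ n) - n * RX) / (n * ξ n) : ℝ) : EReal)) atTop
      ≤ (θ.1 : EReal) ∧
    limsup (fun n : ℕ => (((Real.log (N₂ n) - n * RY) / (n * ξ n) : ℝ) : EReal)) atTop
      ≤ (θ.2 : EReal) ∧
    (ν : EReal) ≤ liminf (fun n : ℕ => ((-Real.log (ε n) / (n * ξ n ^ 2) : ℝ) : EReal)) atTop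

/-- The moderate deviations constant `ν*(RX, RY, θ, T)`: the supremum, in the extended reals, of
all achievable moderate deviations constants. -/
def nuStar {𝒳 𝒴 : Type*} [MeasurableSpace 𝒳] [MeasurableSpace 𝒴] (P : PMF (𝒳 × 𝒴))
    (ξ : ℕ → ℝ) (RX RY : ℝ) (θ : ℝ × ℝ) (T : ℕ) : EReal :=
  sSup ((fun ν : ℝ => (ν : EReal)) '' {ν | Achievable P ξ RX RY θ T ν})

end

end StreamingSW

namespace StreamingSW
noncomputable section

/-! ### Analytic preliminaries -/

/-! The code is causal random binning. At each time each encoder hashes its entire past into a fresh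
uniform bin, and decoder `k` picks the likeliest tuple of all `K = k + T` blocks that agrees with
every codeword received so far.

An error in block `k` produces a competitor at least as likely as the truth, whose two coordinates
first differ from it in blocks `j₁`, `j₂` with `min j₁ j₂ ≤ k`. All prefixes from the first
difference onwards differ, so it survives with probability at most `N₁ ^ -(K - j₁) * N₂ ^ -(K - j₂)`
(`binning_collision`). Counting such competitors, truncating the union bound at 1 and raising it to
a power `s ∈ [0, 1]` makes the average factor over blocks and symbols (`sum_prod_mul_le`,
`errorProb_binningCode_le`). The factors are moment generating functions at `s` of the information
densities: conditional where one coordinate is wrong, joint where both are.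

With `s = t * ξ n` a second-order expansion gives, per symbol, the exponent `ξ n ^ 2 * (t * τ - t ^
2 * V / 2)` for backoff `τ * ξ n` and dispersion `V`, and `t` may depend on the proportion `γ` of
blocks of each kind (`eventually_hasExponent`). Every pattern spans at least `T` blocks, which
yields the factor `T`; the sum over patterns is geometric, hence bounded uniformly in `k`
(`sum_exp_first_difference_le`).

`le_nuStar` assembles this for arbitrary backoffs from the three Slepian-Wolf constraints. A
constraint slack by a positive constant has, eventually, any backoff one likes, so only the tight
ones determine each case. -/

theorem exp_le_quadratic_add_cube {x : ℝ} (hx : |x| ≤ 1) :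
    Real.exp x ≤ 1 + x + x ^ 2 / 2 + |x| ^ 3 := by
  have h := Real.exp_bound hx (n := 3) (by norm_num)
  simp only [Finset.sum_range_succ, Finset.sum_range_zero, Nat.factorial] at h
  have h3 : 0 ≤ |x| ^ 3 := by positivity
  have := (abs_le.mp h).2
  norm_num at this
  linarith

/-- Second-order bound on the moment generating function of a random variable on a finite set. -/
theorem exists_mgf_le {α : Type*} [Fintype α] (p : α → ℝ) (hp : ∀ a, 0 ≤ p a)
    (hsum : ∑ a, p a = 1) (W : α → ℝ) {μ V : ℝ} (hμ : ∑ a, p a * W a = μ)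
    (hV : ∑ a, p a * (W a - μ) ^ 2 = V) {η : ℝ} (hη : 0 < η) :
    ∃ s₀ > 0, ∀ s, 0 ≤ s → s ≤ s₀ →
      ∑ a, p a * Real.exp (s * W a) ≤ Real.exp (s * μ + s ^ 2 * (V + η) / 2) := by
  set M : ℝ := 1 + ∑ a, |W a - μ| with hM
  have hM1 : 1 ≤ M := by
    have : 0 ≤ ∑ a, |W a - μ| := Finset.sum_nonneg fun a _ => abs_nonneg _
    linarith
  have hWM : ∀ a, |W a - μ| ≤ M := fun a => by
    have := Finset.single_le_sum (f := fun a => |W a - μ|) (fun b _ => abs_nonneg _)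
      (Finset.mem_univ a)
    linarith
  -- The first bound keeps `|s * (W a - μ)| ≤ 1`, where the cubic estimate of `exp` is valid; the
  -- second lets `s ^ 2 * η / 2` absorb the cubic remainder.
  refine ⟨min (1 / M) (η / (2 * M ^ 3)), by positivity, fun s hs0 hs => ?_⟩
  have hs1 : s * M ≤ 1 := by
    have := hs.trans (min_le_left _ _)
    rwa [le_div_iff₀ (by positivity)] at this
  have hs2 : s * M ^ 3 ≤ η / 2 := by
    have := hs.trans (min_le_right _ _)
    rw [le_div_iff₀ (by positivity)] at this
    linarith
  have key : ∀ a, p a * Real.exp (s * (W a - μ)) ≤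
      p a * (1 + s ^ 3 * M ^ 3) + s * (p a * W a - p a * μ)
        + s ^ 2 / 2 * (p a * (W a - μ) ^ 2) := by
    intro a
    have hab : |s * (W a - μ)| ≤ s * M := by
      rw [abs_mul, abs_of_nonneg hs0]
      exact mul_le_mul_of_nonneg_left (hWM a) hs0
    have h1 := exp_le_quadratic_add_cube (hab.trans hs1)
    have h2 : |s * (W a - μ)| ^ 3 ≤ (s * M) ^ 3 := pow_le_pow_left₀ (abs_nonneg _) hab 3
    calc p a * Real.exp (s * (W a - μ))
        ≤ p a * (1 + s * (W a - μ) + (s * (W a - μ)) ^ 2 / 2 + (s * M) ^ 3) :=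
          mul_le_mul_of_nonneg_left (by linarith) (hp a)
      _ = _ := by ring
  have hsum2 : ∑ a, p a * Real.exp (s * (W a - μ)) ≤ 1 + s ^ 3 * M ^ 3 + s ^ 2 / 2 * V := by
    refine (Finset.sum_le_sum fun a _ => key a).trans_eq ?_
    rw [Finset.sum_add_distrib, Finset.sum_add_distrib, ← Finset.mul_sum, ← Finset.mul_sum,
      ← Finset.sum_mul, Finset.sum_sub_distrib, ← Finset.sum_mul, hsum, hμ, hV]
    ring
  have hexp : 1 + s ^ 3 * M ^ 3 + s ^ 2 / 2 * V ≤ Real.exp (s ^ 2 * (V + η) / 2) := by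
    have h1 : s ^ 3 * M ^ 3 ≤ s ^ 2 * (η / 2) := by
      calc s ^ 3 * M ^ 3 = s ^ 2 * (s * M ^ 3) := by ring
        _ ≤ _ := mul_le_mul_of_nonneg_left hs2 (by positivity)
    have := Real.add_one_le_exp (s ^ 2 * (V + η) / 2)
    linarith
  calc ∑ a, p a * Real.exp (s * W a)
      = Real.exp (s * μ) * ∑ a, p a * Real.exp (s * (W a - μ)) := by
        rw [Finset.mul_sum]
        refine Finset.sum_congr rfl fun a _ => ?_
        rw [show s * W a = s * μ + s * (W a - μ) by ring, Real.exp_add]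
        ring
    _ ≤ Real.exp (s * μ) * Real.exp (s ^ 2 * (V + η) / 2) :=
        mul_le_mul_of_nonneg_left (hsum2.trans hexp) (Real.exp_pos _).le
    _ = _ := by rw [← Real.exp_add]

/-! ### Counting likely competitors -/

/-- The mass of the admissible competitors of `z`, relative to the mass of `z`. -/
def spread {α : Type*} (p : α → ℝ) (A : α → Finset α) (z : α) : ℝ :=
  (∑ z' ∈ A z, p z') / p z

theorem spread_nonneg {α : Type*} {p : α → ℝ} (hp : ∀ a, 0 ≤ p a) (A : α → Finset α) (z : α) :
    0 ≤ spread p A z :=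
  div_nonneg (Finset.sum_nonneg fun a _ => hp a) (hp z)

theorem spread_pi {ι α : Type*} [Fintype ι] [DecidableEq ι] (p : α → ℝ)
    (A : ι → α → Finset α) (z : ι → α) :
    (∑ z' ∈ Fintype.piFinset fun i => A i (z i), ∏ i, p (z' i)) / ∏ i, p (z i)
      = ∏ i, spread p (A i) (z i) := by
  simp only [spread]
  rw [Finset.prod_div_distrib, Finset.prod_univ_sum]

/-- Each member of `S` has mass at least that of `z`, while together they weigh at most the mass of
the admissible box, which factors over coordinates. -/
theorem card_likely_le {ι α : Type*} [Fintype ι] [DecidableEq ι] {p : α → ℝ}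
    (hp : ∀ a, 0 ≤ p a) (A : ι → α → Finset α) (z : ι → α) (hz : 0 < ∏ i, p (z i))
    (S : Finset (ι → α)) (hSA : ∀ z' ∈ S, ∀ i, z' i ∈ A i (z i))
    (hS : ∀ z' ∈ S, ∏ i, p (z i) ≤ ∏ i, p (z' i)) :
    (S.card : ℝ) ≤ ∏ i, spread p (A i) (z i) := by
  rw [← spread_pi, le_div_iff₀ hz, ← nsmul_eq_mul]
  calc S.card • ∏ i, p (z i) ≤ ∑ z' ∈ S, ∏ i, p (z' i) := Finset.card_nsmul_le_sum _ _ _ hS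
    _ ≤ _ := Finset.sum_le_sum_of_subset_of_nonneg
      (fun z' h => Fintype.mem_piFinset.2 (hSA z' h))
      fun z' _ _ => Finset.prod_nonneg fun i _ => hp _

/-- Gallager's device: a union bound truncated at 1 may be replaced by any of its powers `s ∈ [0,
1]`, and `s` is optimized later. -/
theorem le_rpow_of_le_one {x y s : ℝ} (hx1 : x ≤ 1) (hxy : x ≤ y) (hy : 0 ≤ y)
    (hs0 : 0 ≤ s) (hs1 : s ≤ 1) : x ≤ y ^ s := by
  rcases le_total y 1 with h | h
  · rcases hy.eq_or_lt with rfl | hy'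
    · exact hxy.trans (Real.rpow_nonneg le_rfl s)
    · calc x ≤ y := hxy
        _ = y ^ (1 : ℝ) := (Real.rpow_one y).symm
        _ ≤ y ^ s := Real.rpow_le_rpow_of_exponent_ge hy' h hs1
  · exact hx1.trans (Real.one_le_rpow h hs0)

/-- The average of the truncated union bound is at most a product of fractional moments. -/
theorem sum_prod_mul_le {ι α : Type*} [Fintype ι] [DecidableEq ι] [Fintype α] {p : α → ℝ}
    (hp : ∀ a, 0 ≤ p a) (A : ι → α → Finset α) (S : (ι → α) → Finset (ι → α))
    (hSA : ∀ z, ∀ z' ∈ S z, ∀ i, z' i ∈ A i (z i))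
    (hS : ∀ z, ∀ z' ∈ S z, ∏ i, p (z i) ≤ ∏ i, p (z' i))
    {κ s : ℝ} (hκ : 0 ≤ κ) (hs0 : 0 ≤ s) (hs1 : s ≤ 1) (e : (ι → α) → ℝ)
    (he1 : ∀ z, e z ≤ 1) (heS : ∀ z, e z ≤ (S z).card * κ) :
    ∑ z : ι → α, (∏ i, p (z i)) * e z ≤ κ ^ s * ∏ i, ∑ a, p a * spread p (A i) a ^ s := by
  rw [Finset.prod_univ_sum, Fintype.piFinset_univ, Finset.mul_sum]
  refine Finset.sum_le_sum fun z _ => ?_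
  have h0 : 0 ≤ ∏ i, p (z i) := Finset.prod_nonneg fun i _ => hp _
  rw [Finset.prod_mul_distrib, mul_left_comm]
  rcases h0.eq_or_lt with h | h
  · rw [← h]; simp
  refine mul_le_mul_of_nonneg_left ?_ h0
  have hsp : 0 ≤ ∏ i, spread p (A i) (z i) :=
    Finset.prod_nonneg fun i _ => spread_nonneg hp _ _
  rw [Real.finsetProd_rpow _ _ (fun i _ => spread_nonneg hp _ _), ← Real.mul_rpow hκ hsp]
  refine le_rpow_of_le_one (he1 z) ((heS z).trans ?_) (mul_nonneg hκ hsp) hs0 hs1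
  rw [mul_comm κ]
  exact mul_le_mul_of_nonneg_right (card_likely_le hp A z h (S z) (hSA z) (hS z)) hκ

/-- Single-letterization inside a block: its symbols are i.i.d., so the fractional moment of the
block is a power of that of one symbol. -/
theorem sum_prod_spread_rpow {ι α : Type*} [Fintype ι] [DecidableEq ι] [Fintype α] {p : α → ℝ}
    (hp : ∀ a, 0 ≤ p a) (A : α → Finset α) (s : ℝ) :
    ∑ z : ι → α, (∏ i, p (z i)) *
      spread (fun z : ι → α => ∏ i, p (z i)) (fun z => Fintype.piFinset fun i => A (z i)) z ^ s
      = (∑ a, p a * spread p A a ^ s) ^ Fintype.card ι := by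
  have : (∑ a, p a * spread p A a ^ s) ^ Fintype.card ι
      = ∏ _i : ι, ∑ a, p a * spread p A a ^ s := by simp
  rw [this, Finset.prod_univ_sum, Fintype.piFinset_univ]
  refine Finset.sum_congr rfl fun z _ => ?_
  rw [Finset.prod_mul_distrib, Real.finsetProd_rpow _ _ (fun i _ => spread_nonneg hp _ _)]
  congr 2
  exact spread_pi p (fun _ => A) z

/-! ### Random hashing -/

/-- The law of a doubly indexed family of independent uniform elements of `Fin N`. -/
def hashLaw (N : ℕ) [NeZero N] : Measure (ℕ → ℕ → Fin N) :=
  Measure.infinitePi fun _ : ℕ => Measure.infinitePi fun _ : ℕ =>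
    (PMF.uniformOfFintype (Fin N)).toMeasure

instance (N : ℕ) [NeZero N] : IsProbabilityMeasure (hashLaw N) := by
  unfold hashLaw; infer_instance

/-- A union over the common value `c` gives `N` events of probability `N⁻¹ * N⁻¹`. -/
theorem infinitePi_uniform_collision {N : ℕ} [NeZero N] {a b : ℕ} (h : a ≠ b) :
    (Measure.infinitePi fun _ : ℕ => (PMF.uniformOfFintype (Fin N)).toMeasure)
      {v | v a = v b} ≤ (N : ENNReal)⁻¹ := by
  set μ := Measure.infinitePi fun _ : ℕ => (PMF.uniformOfFintype (Fin N)).toMeasure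
  have hN0 : (N : ENNReal) ≠ 0 := by exact_mod_cast NeZero.ne N
  have hsub : {v : ℕ → Fin N | v a = v b} ⊆
      ⋃ c ∈ (Finset.univ : Finset (Fin N)), Set.pi ({a, b} : Finset ℕ) fun _ => {c} := by
    intro v hv
    simp only [Set.mem_iUnion]
    refine ⟨v a, Finset.mem_univ _, ?_⟩
    intro i hi
    simp only [Finset.coe_insert, Finset.coe_singleton, Set.mem_insert_iff,
      Set.mem_singleton_iff] at hi
    rcases hi with rfl | rfl
    · rfl
    · exact Eq.symm hv
  have hc : ∀ c : Fin N, μ (Set.pi ({a, b} : Finset ℕ) fun _ => {c})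
      = (N : ENNReal)⁻¹ * (N : ENNReal)⁻¹ := by
    intro c
    rw [Measure.infinitePi_pi _ (fun i _ => measurableSet_singleton c), Finset.prod_pair h,
      PMF.toMeasure_apply_singleton _ _ (measurableSet_singleton c)]
    simp
  calc μ {v | v a = v b}
      ≤ ∑ c : Fin N, μ (Set.pi ({a, b} : Finset ℕ) fun _ => {c}) :=
        (measure_mono hsub).trans (measure_biUnion_finset_le _ _)
    _ = (N : ENNReal)⁻¹ := by
        simp only [hc, Finset.sum_const, Finset.card_univ, Fintype.card_fin, nsmul_eq_mul]
        rw [← mul_assoc, ENNReal.mul_inv_cancel hN0 (ENNReal.natCast_ne_top N), one_mul]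

theorem hashLaw_collision {N : ℕ} [NeZero N] (S : Finset ℕ) (p q : ℕ → ℕ)
    (h : ∀ i ∈ S, p i ≠ q i) :
    (hashLaw N).real {u | ∀ i ∈ S, u i (p i) = u i (q i)} ≤ ((N : ℝ)⁻¹) ^ S.card := by
  have hset : {u : ℕ → ℕ → Fin N | ∀ i ∈ S, u i (p i) = u i (q i)}
      = Set.pi S fun i => {v | v (p i) = v (q i)} := by
    ext u; simp [Set.mem_pi]
  have hle : hashLaw N {u | ∀ i ∈ S, u i (p i) = u i (q i)} ≤ ((N : ENNReal)⁻¹) ^ S.card := by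
    rw [hset, hashLaw, Measure.infinitePi_pi]
    · exact Finset.prod_le_pow_card _ _ _ fun i hi => infinitePi_uniform_collision (h i hi)
    · intro i _
      exact measurableSet_eq_fun (measurable_pi_apply _) (measurable_pi_apply _)
  have hN0 : (N : ENNReal) ≠ 0 := by exact_mod_cast NeZero.ne N
  have := ENNReal.toReal_mono (by simp [hN0]) hle
  simpa [Measure.real] using this

/-- A numbering of the elements of a finite type. -/
def index {β : Type*} [Finite β] (x : β) : ℕ := Finite.equivFin β x

theorem index_injective {β : Type*} [Finite β] : Function.Injective (index (β := β)) :=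
  fun _ _ h => (Finite.equivFin β).injective (Fin.ext h)

/-- The codewords of the first `K` blocks of a source sequence under causal random binning. -/
def binning {α : Type*} [Finite α] {n N K : ℕ} (u : ℕ → ℕ → Fin N) (x : Fin K → Fin n → α)
    (i : Fin K) : Fin N :=
  u i (index fun j : Fin (i + 1) => x (Fin.castLE i.2 j))

theorem measurable_binning {α : Type*} [Finite α] {n N K : ℕ} :
    Measurable (fun u : ℕ → ℕ → Fin N => binning (α := α) (n := n) (K := K) u) := by
  refine measurable_pi_lambda _ fun x => measurable_pi_lambda _ fun i => ?_
  exact (measurable_pi_apply _).comp (measurable_pi_apply _)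

/-- Once block `j` differs, so does every longer prefix, and hash rows at different times are
independent: one factor `N⁻¹` per time from `j` to `K - 1`. The value `j = K` stands for no
difference and gives the trivial bound 1. -/
theorem binning_collision {α : Type*} [Finite α] {n N K : ℕ} [NeZero N]
    (x x' : Fin K → Fin n → α) (j : ℕ) (hj : ∀ h : j < K, x ⟨j, h⟩ ≠ x' ⟨j, h⟩) :
    (hashLaw N).real {u | binning u x = binning u x'} ≤ ((N : ℝ)⁻¹) ^ (K - j) := by
  let p : (Fin K → Fin n → α) → ℕ → ℕ := fun x i =>
    if h : i < K then index fun j : Fin (i + 1) => x (Fin.castLE h j) else 0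
  have hcol := hashLaw_collision (N := N) (Finset.Ico j K) (p x) (p x') (by
    intro i hi
    rw [Finset.mem_Ico] at hi
    simp only [p, hi.2, dif_pos]
    intro heq
    have := congrFun (index_injective heq) ⟨j, by omega⟩
    exact hj (by omega) this)
  rw [Nat.card_Ico] at hcol
  refine le_trans (measureReal_mono ?_) hcol
  intro u hu i hi
  rw [Finset.mem_Ico] at hi
  have := congrFun hu ⟨i, hi.2⟩
  simp only [p, hi.2, dif_pos]
  exact this

theorem exists_first_difference {α : Type*} {K : ℕ} (x x' : Fin K → α) :
    ∃ j ≤ K, (∀ i : Fin K, (i : ℕ) < j → x' i = x i) ∧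
      ∀ h : j < K, x ⟨j, h⟩ ≠ x' ⟨j, h⟩ := by
  classical
  have hex : ∃ j, ∀ h : j < K, x ⟨j, h⟩ ≠ x' ⟨j, h⟩ := ⟨K, fun h => absurd h (lt_irrefl _)⟩
  refine ⟨Nat.find hex, Nat.find_min' hex fun h => absurd h (lt_irrefl _), fun i hi => ?_,
    Nat.find_spec hex⟩
  have := Nat.find_min hex hi
  push Not at this
  exact this.2.symm

/-! ### The code -/

section Coding

variable {𝒳 𝒴 : Type*} [Finite 𝒳] [Finite 𝒴]

/-- Likelihood of a tuple of blocks. -/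
def likelihood {α : Type*} (p : α → ℝ) {K n : ℕ} (b : Fin K → Fin n → α) : ℝ :=
  ∏ i, ∏ t, p (b i t)

/-- `b` is consistent with the observed codewords. -/
def Consistent {n N₁ N₂ K : ℕ} (F : (Fin K → Fin n → 𝒳) → Fin K → Fin N₁)
    (G : (Fin K → Fin n → 𝒴) → Fin K → Fin N₂) (m₁ : Fin K → Fin N₁) (m₂ : Fin K → Fin N₂)
    (b : Fin K → Fin n → 𝒳 × 𝒴) : Prop :=
  F (fun i t => (b i t).1) = m₁ ∧ G (fun i t => (b i t).2) = m₂

/-- Maximum likelihood decoding among the consistent tuples of blocks. -/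
def decode [Nonempty (𝒳 × 𝒴)] (p : 𝒳 × 𝒴 → ℝ) {n N₁ N₂ K : ℕ}
    (F : (Fin K → Fin n → 𝒳) → Fin K → Fin N₁)
    (G : (Fin K → Fin n → 𝒴) → Fin K → Fin N₂) (m₁ : Fin K → Fin N₁) (m₂ : Fin K → Fin N₂) :
    Fin K → Fin n → 𝒳 × 𝒴 :=
  Classical.epsilon fun b => Consistent F G m₁ m₂ b ∧
    ∀ b', Consistent F G m₁ m₂ b' → likelihood p b' ≤ likelihood p b

/-- There are finitely many tuples and `b₀` is consistent, so a maximizer exists and the choice in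
`decode` is a genuine one. -/
theorem decode_spec [Nonempty (𝒳 × 𝒴)] (p : 𝒳 × 𝒴 → ℝ) {n N₁ N₂ K : ℕ}
    (F : (Fin K → Fin n → 𝒳) → Fin K → Fin N₁)
    (G : (Fin K → Fin n → 𝒴) → Fin K → Fin N₂) {m₁ : Fin K → Fin N₁} {m₂ : Fin K → Fin N₂}
    {b₀ : Fin K → Fin n → 𝒳 × 𝒴} (h : Consistent F G m₁ m₂ b₀) :
    Consistent F G m₁ m₂ (decode p F G m₁ m₂) ∧
      likelihood p b₀ ≤ likelihood p (decode p F G m₁ m₂) := by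
  obtain ⟨b, hb, hmax⟩ := Set.exists_max_image {b | Consistent F G m₁ m₂ b} (likelihood p)
    (Set.toFinite _) ⟨b₀, h⟩
  have := Classical.epsilon_spec (p := fun b => Consistent F G m₁ m₂ b ∧
    ∀ b', Consistent F G m₁ m₂ b' → likelihood p b' ≤ likelihood p b) ⟨b, hb, hmax⟩
  exact ⟨this.1, this.2 b₀ h⟩

/-- The streaming code given by causal random binning and maximum likelihood decoding. -/
def binningCode [Nonempty (𝒳 × 𝒴)] (p : 𝒳 × 𝒴 → ℝ) (n N₁ N₂ T : ℕ) [NeZero N₁] [NeZero N₂]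
    (hT : 1 ≤ T) : Code 𝒳 𝒴 n N₁ N₂ T where
  -- Prefixes enter only through their numbers, so the randomness does not involve the source
  -- alphabets.
  Rnd := (ℕ → ℕ → Fin N₁) × (ℕ → ℕ → Fin N₂)
  mRnd := inferInstance
  law := (hashLaw N₁).prod (hashLaw N₂)
  isProb := inferInstance
  f k u x := u.1 k (index x)
  g k u y := u.2 k (index y)
  φ k u m₁ m₂ :=
    let b := decode p (binning u.1) (binning u.2) m₁ m₂
    (fun t => (b ⟨k, by omega⟩ t).1, fun t => (b ⟨k, by omega⟩ t).2)
  measurable_f k x i :=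
    (show Measurable fun u : (ℕ → ℕ → Fin N₁) × (ℕ → ℕ → Fin N₂) => u.1 k (index x) by
      fun_prop) (measurableSet_singleton i)
  measurable_g k x i :=
    (show Measurable fun u : (ℕ → ℕ → Fin N₁) × (ℕ → ℕ → Fin N₂) => u.2 k (index x) by
      fun_prop) (measurableSet_singleton i)
  measurable_φ k m₁ m₂ b := by
    let D : ((Fin (k + T) → Fin n → 𝒳) → Fin (k + T) → Fin N₁) ×
        ((Fin (k + T) → Fin n → 𝒴) → Fin (k + T) → Fin N₂) → (Fin n → 𝒳) × (Fin n → 𝒴) :=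
      fun w => (fun t => (decode p w.1 w.2 m₁ m₂ ⟨k, by omega⟩ t).1,
        fun t => (decode p w.1 w.2 m₁ m₂ ⟨k, by omega⟩ t).2)
    have hm : Measurable fun u : (ℕ → ℕ → Fin N₁) × (ℕ → ℕ → Fin N₂) =>
        ((binning u.1 : (Fin (k + T) → Fin n → 𝒳) → Fin (k + T) → Fin N₁),
          (binning u.2 : (Fin (k + T) → Fin n → 𝒴) → Fin (k + T) → Fin N₂)) :=
      (measurable_binning.comp measurable_fst).prodMk (measurable_binning.comp measurable_snd)
    -- The decoder depends on `u` only through the pair of binning functions, which takes finitely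
    -- many values.
    exact hm (Set.toFinite (D ⁻¹' {b})).measurableSet

end Coding

/-! ### The error probability of causal random binning -/

instance {𝒳 𝒴 : Type*} [MeasurableSpace 𝒳] [MeasurableSpace 𝒴] (P : PMF (𝒳 × 𝒴)) (n : ℕ) : IsProbabilityMeasure (sourceLaw P n) := by
  unfold sourceLaw; infer_instance

theorem sourceLaw_cylinder {𝒳 𝒴 : Type*} [MeasurableSpace 𝒳] [MeasurableSpace 𝒴]
    [MeasurableSingletonClass 𝒳] [MeasurableSingletonClass 𝒴] (P : PMF (𝒳 × 𝒴)) (n K : ℕ) (b : Fin K → Fin n → 𝒳 × 𝒴) :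
    (sourceLaw P n).real {s | ∀ i : Fin K, s i = b i}
      = likelihood (fun z => (P z).toReal) b := by
  have hset : {s : ℕ → Fin n → 𝒳 × 𝒴 | ∀ i : Fin K, s i = b i} =
      Set.pi (Finset.range K) fun i => if h : i < K then {b ⟨i, h⟩} else Set.univ := by
    ext s
    simp only [Set.mem_pi, Finset.coe_range, Set.mem_Iio]
    constructor
    · intro h i hi
      simp only [hi, dif_pos]
      exact h ⟨i, hi⟩
    · intro h i
      have := h i i.2
      simpa [i.2] using this
  rw [hset, sourceLaw, Measure.real, Measure.infinitePi_pi _ (by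
    intro i hi
    rw [Finset.mem_range] at hi
    simp only [hi, dif_pos]
    exact measurableSet_singleton _), Finset.prod_range]
  simp only [Fin.is_lt, dif_pos, Fin.eta, Measure.pi_singleton, ENNReal.toReal_prod, likelihood]
  refine Finset.prod_congr rfl fun i _ => Finset.prod_congr rfl fun t _ => ?_
  rw [PMF.toMeasure_apply_singleton _ _ (measurableSet_singleton _)]

section ErrorBound

variable {𝒳 𝒴 : Type*} [Fintype 𝒳] [Fintype 𝒴]

open Classical in
/-- The symbol pairs that agree with `z` in the first coordinate if `a` holds, and in the second
coordinate if `b` holds. -/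
def admissible (a b : Prop) (z : 𝒳 × 𝒴) : Finset (𝒳 × 𝒴) :=
  Finset.univ.filter fun z' => (a → z'.1 = z.1) ∧ (b → z'.2 = z.2)

/-- The fractional moment of the number of likely competitors of a random symbol pair. -/
def moment (p : 𝒳 × 𝒴 → ℝ) (s : ℝ) (a b : Prop) : ℝ :=
  ∑ z, p z * spread p (admissible a b) z ^ s

theorem moment_nonneg {p : 𝒳 × 𝒴 → ℝ} (hp : ∀ z, 0 ≤ p z) (s : ℝ) (a b : Prop) :
    0 ≤ moment p s a b :=
  Finset.sum_nonneg fun z _ => mul_nonneg (hp z) (Real.rpow_nonneg (spread_nonneg hp _ z) s)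

open Classical in
/-- The tuples of blocks that are at least as likely as `b₀` and whose coordinates first differ
from those of `b₀` in block `j.1` and in block `j.2`, respectively. -/
def competitors (p : 𝒳 × 𝒴 → ℝ) {K n : ℕ} (j : ℕ × ℕ) (b₀ : Fin K → Fin n → 𝒳 × 𝒴) :
    Finset (Fin K → Fin n → 𝒳 × 𝒴) :=
  Finset.univ.filter fun b => likelihood p b₀ ≤ likelihood p b ∧
    ((∀ i : Fin K, (i : ℕ) < j.1 → (fun t => (b i t).1) = fun t => (b₀ i t).1) ∧
      ∀ h : j.1 < K, (fun t => (b₀ ⟨j.1, h⟩ t).1) ≠ fun t => (b ⟨j.1, h⟩ t).1) ∧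
    ((∀ i : Fin K, (i : ℕ) < j.2 → (fun t => (b i t).2) = fun t => (b₀ i t).2) ∧
      ∀ h : j.2 < K, (fun t => (b₀ ⟨j.2, h⟩ t).2) ≠ fun t => (b ⟨j.2, h⟩ t).2)

/-- The realizations of the common randomness for which `b₀` and `b` have the same codewords. -/
def collisionSet (N₁ N₂ : ℕ) {K n : ℕ} (b₀ b : Fin K → Fin n → 𝒳 × 𝒴) :
    Set ((ℕ → ℕ → Fin N₁) × (ℕ → ℕ → Fin N₂)) :=
  {u | binning u.1 (fun i t => (b₀ i t).1) = binning u.1 (fun i t => (b i t).1)} ∩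
    {u | binning u.2 (fun i t => (b₀ i t).2) = binning u.2 (fun i t => (b i t).2)}

/-- The probability bound for a collision of tuples that first differ in blocks `j`. -/
def collisionBound (N₁ N₂ K : ℕ) (j : ℕ × ℕ) : ℝ :=
  ((N₁ : ℝ)⁻¹) ^ (K - j.1) * ((N₂ : ℝ)⁻¹) ^ (K - j.2)

theorem collisionSet_le {p : 𝒳 × 𝒴 → ℝ} {N₁ N₂ K n : ℕ} [NeZero N₁] [NeZero N₂] {j : ℕ × ℕ}
    {b₀ b : Fin K → Fin n → 𝒳 × 𝒴} (hb : b ∈ competitors p j b₀) :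
    ((hashLaw N₁).prod (hashLaw N₂)).real (collisionSet N₁ N₂ b₀ b)
      ≤ collisionBound N₁ N₂ K j := by
  simp only [competitors, Finset.mem_filter] at hb
  have hset : collisionSet N₁ N₂ b₀ b =
      {u | binning u (fun i t => (b₀ i t).1) = binning u (fun i t => (b i t).1)} ×ˢ
        {u | binning u (fun i t => (b₀ i t).2) = binning u (fun i t => (b i t).2)} := rfl
  rw [hset, measureReal_prod_prod]
  exact mul_le_mul (binning_collision _ _ _ hb.2.2.1.2) (binning_collision _ _ _ hb.2.2.2.2)
    measureReal_nonneg (by positivity)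

/-- If both first differences came after block `k`, the tuples would agree in block `k`. -/
theorem exists_mem_competitors {p : 𝒳 × 𝒴 → ℝ} {K n : ℕ} {b₀ b : Fin K → Fin n → 𝒳 × 𝒴}
    (hl : likelihood p b₀ ≤ likelihood p b) {k : Fin K} (hk : b k ≠ b₀ k) :
    ∃ j ∈ (Finset.range (K + 1) ×ˢ Finset.range (K + 1)).filter
      (fun j : ℕ × ℕ => min j.1 j.2 ≤ k), b ∈ competitors p j b₀ := by
  obtain ⟨j₁, hj₁, h₁, h₁'⟩ :=
    exists_first_difference (fun i t => (b₀ i t).1) (fun i t => (b i t).1)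
  obtain ⟨j₂, hj₂, h₂, h₂'⟩ :=
    exists_first_difference (fun i t => (b₀ i t).2) (fun i t => (b i t).2)
  refine ⟨(j₁, j₂), ?_, ?_⟩
  · simp only [Finset.mem_filter, Finset.mem_product, Finset.mem_range]
    refine ⟨⟨by omega, by omega⟩, ?_⟩
    by_contra! hlt
    rw [lt_min_iff] at hlt
    exact hk (funext fun t => Prod.ext (congrFun (h₁ k hlt.1) t) (congrFun (h₂ k hlt.2) t))
  · simp only [competitors, Finset.mem_filter]
    exact ⟨Finset.mem_univ _, hl, ⟨h₁, h₁'⟩, ⟨h₂, h₂'⟩⟩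

variable [MeasurableSpace 𝒳] [MeasurableSpace 𝒴]
  [MeasurableSingletonClass 𝒳] [MeasurableSingletonClass 𝒴]

/-- The union bound is split by the pair `j` of first differences before it is truncated, so each
`j` may have its own exponent `σ j`. -/
theorem errorProb_binningCode_le [Nonempty (𝒳 × 𝒴)] (P : PMF (𝒳 × 𝒴)) (n N₁ N₂ T : ℕ)
    [NeZero N₁] [NeZero N₂] (hT : 1 ≤ T) (k : ℕ) (σ : ℕ × ℕ → ℝ)
    (hσ : ∀ j, 0 ≤ σ j ∧ σ j ≤ 1) :
    (binningCode (fun z => (P z).toReal) n N₁ N₂ T hT).errorProb P k ≤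
      ∑ j ∈ (Finset.range (k + T + 1) ×ˢ Finset.range (k + T + 1)).filter
          (fun j : ℕ × ℕ => min j.1 j.2 ≤ k),
        collisionBound N₁ N₂ (k + T) j ^ σ j *
          ∏ i : Fin (k + T), moment (fun z => (P z).toReal) (σ j) (i < j.1) (i < j.2) ^ n := by
  classical
  set p : 𝒳 × 𝒴 → ℝ := fun z => (P z).toReal with hp_def
  have hp : ∀ z, 0 ≤ p z := fun z => ENNReal.toReal_nonneg
  set K := k + T with hK
  set kk : Fin K := ⟨k, by omega⟩ with hkk
  set J := (Finset.range (K + 1) ×ˢ Finset.range (K + 1)).filter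
          (fun j : ℕ × ℕ => min j.1 j.2 ≤ k) with hJ
  set ℓ := (hashLaw N₁).prod (hashLaw N₂) with hℓ
  set B := Fin K → Fin n → 𝒳 × 𝒴
  let E : ℕ × ℕ → B → Set ((ℕ → ℕ → Fin N₁) × (ℕ → ℕ → Fin N₂)) := fun j b₀ =>
    ⋃ b ∈ competitors p j b₀, collisionSet N₁ N₂ b₀ b
  have hE1 : ∀ j b₀, ℓ.real (E j b₀) ≤ 1 := fun j b₀ => measureReal_le_one
  have hEcard : ∀ j (b₀ : B), ℓ.real (E j b₀) ≤
      (competitors p j b₀).card * collisionBound N₁ N₂ K j := by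
    intro j b₀
    refine (measureReal_biUnion_finset_le _ _).trans ?_
    rw [← nsmul_eq_mul]
    exact Finset.sum_le_card_nsmul _ _ _ fun b hb => collisionSet_le hb
  -- Only monotonicity of the measure is needed: the error event sits inside a finite union of
  -- rectangles, indexed by the true tuple `b₀`.
  have hcover : {w : ((ℕ → ℕ → Fin N₁) × (ℕ → ℕ → Fin N₂)) × (ℕ → Fin n → 𝒳 × 𝒴) |
      (binningCode p n N₁ N₂ T hT).estimate k w.1 w.2 ≠
        (fun t => (w.2 k t).1, fun t => (w.2 k t).2)} ⊆
      ⋃ b₀ : B, (⋃ j ∈ J, E j b₀) ×ˢ {s | ∀ i : Fin K, s i = b₀ i} := by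
    rintro ⟨u, s⟩ hw
    let b₀ : B := fun i => s i
    have hcons : Consistent (binning (K := K) (n := n) u.1) (binning (K := K) (n := n) u.2)
      (binning u.1 fun i t => (b₀ i t).1) (binning u.2 fun i t => (b₀ i t).2) b₀ := ⟨rfl, rfl⟩
    obtain ⟨hc, hl⟩ := decode_spec p _ _ hcons
    set b := decode p (binning (K := K) (n := n) u.1) (binning (K := K) (n := n) u.2)
      (binning u.1 fun i t => (b₀ i t).1) (binning u.2 fun i t => (b₀ i t).2) with hb
    have hne : b kk ≠ b₀ kk := by
      intro heq
      refine hw ?_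
      change ((fun t => (b kk t).1, fun t => (b kk t).2) : (Fin n → 𝒳) × (Fin n → 𝒴)) = _
      rw [heq]
    obtain ⟨j, hj, hbj⟩ := exists_mem_competitors hl hne
    simp only [Set.mem_iUnion, Set.mem_prod]
    exact ⟨b₀, ⟨j, hj, Set.mem_biUnion hbj ⟨hc.1.symm, hc.2.symm⟩⟩, fun i => rfl⟩
  have h1 : (binningCode p n N₁ N₂ T hT).errorProb P k ≤
      ∑ b₀ : B, ∑ j ∈ J, likelihood p b₀ * ℓ.real (E j b₀) := by
    change (ℓ.prod (sourceLaw P n)).real _ ≤ _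
    refine (measureReal_mono hcover).trans ((measureReal_iUnion_fintype_le _).trans ?_)
    refine Finset.sum_le_sum fun b₀ _ => ?_
    rw [measureReal_prod_prod, sourceLaw_cylinder, mul_comm, ← Finset.mul_sum]
    exact mul_le_mul_of_nonneg_left (measureReal_biUnion_finset_le _ _)
      (Finset.prod_nonneg fun i _ => Finset.prod_nonneg fun t _ => hp _)
  refine h1.trans ?_
  rw [Finset.sum_comm]
  refine Finset.sum_le_sum fun j _ => ?_
  have h2 := sum_prod_mul_le (ι := Fin K) (p := fun β : Fin n → 𝒳 × 𝒴 => ∏ t, p (β t))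
    (fun β => Finset.prod_nonneg fun t _ => hp _)
    (fun i β => Fintype.piFinset fun t => admissible ((i : ℕ) < j.1) ((i : ℕ) < j.2) (β t))
    (fun b₀ => competitors p j b₀)
    (by
      intro b₀ b hb i
      simp only [competitors, Finset.mem_filter] at hb
      simp only [Fintype.mem_piFinset, admissible, Finset.mem_filter]
      exact fun t => ⟨Finset.mem_univ _, fun h => congrFun (hb.2.2.1.1 i h) t,
        fun h => congrFun (hb.2.2.2.1 i h) t⟩)
    (by
      intro b₀ b hb
      simp only [competitors, Finset.mem_filter] at hb
      exact hb.2.1)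
    (κ := collisionBound N₁ N₂ K j) (s := σ j) (by unfold collisionBound; positivity)
    (hσ j).1 (hσ j).2 (fun b₀ => ℓ.real (E j b₀)) (hE1 j) (hEcard j)
  refine h2.trans_eq ?_
  congr 1
  refine Finset.prod_congr rfl fun i _ => ?_
  rw [sum_prod_spread_rpow hp, Fintype.card_fin, moment]

end ErrorBound

/-! ### Moments and information densities -/

section Moments

variable {𝒳 𝒴 : Type*} [Fintype 𝒳] [Fintype 𝒴]

theorem sum_toReal {α : Type*} [Fintype α] (P : PMF α) : ∑ z, (P z).toReal = 1 := by
  rw [← ENNReal.toReal_sum fun z _ => P.apply_ne_top z, ← tsum_fintype (L := .unconditional _),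
    P.tsum_coe, ENNReal.toReal_one]

theorem map_snd_toReal (P : PMF (𝒳 × 𝒴)) (y : 𝒴) :
    (P.map Prod.snd y).toReal = ∑ x, (P (x, y)).toReal := by
  classical
  rw [PMF.map_apply, tsum_fintype, Fintype.sum_prod_type,
    ← ENNReal.toReal_sum fun z _ => P.apply_ne_top _]
  simp

theorem swap_apply {α β : Type*} (P : PMF (α × β)) (z : α × β) : swap P z.swap = P z := by
  classical
  rw [swap, PMF.map_apply, tsum_eq_single z]
  · simp
  · intro z' h
    rw [if_neg fun h' => h (Prod.swap_injective h').symm]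

theorem swap_map_snd {α β : Type*} (P : PMF (α × β)) : (swap P).map Prod.snd = P.map Prod.fst := by
  rw [swap, PMF.map_comp]; rfl

theorem map_fst_toReal (P : PMF (𝒳 × 𝒴)) (x : 𝒳) :
    (P.map Prod.fst x).toReal = ∑ y, (P (x, y)).toReal := by
  rw [← swap_map_snd, map_snd_toReal]
  exact Finset.sum_congr rfl fun y _ => by rw [← swap_apply P (x, y)]; rfl

theorem toReal_le_map_snd (P : PMF (𝒳 × 𝒴)) (z : 𝒳 × 𝒴) :
    (P z).toReal ≤ (P.map Prod.snd z.2).toReal := by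
  rw [map_snd_toReal]
  exact Finset.single_le_sum (f := fun x => (P (x, z.2)).toReal)
    (fun _ _ => ENNReal.toReal_nonneg) (Finset.mem_univ z.1)

theorem sum_swap (P : PMF (𝒳 × 𝒴)) (f : 𝒴 × 𝒳 → ℝ) :
    ∑ w, (swap P w).toReal * f w = ∑ z, (P z).toReal * f z.swap := by
  rw [← (Equiv.prodComm 𝒳 𝒴).sum_comp]
  exact Finset.sum_congr rfl fun z _ => by rw [← swap_apply P z]; rfl

/-- This turns fractional moments into moment generating functions; at `p = 0` both sides vanish,
whatever the logarithm is taken to be. -/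
theorem mul_rpow_eq_mul_exp {p q s : ℝ} (hp : 0 ≤ p) (hq : p ≤ q) :
    p * (q / p) ^ s = p * Real.exp (s * -Real.log (p / q)) := by
  rcases hp.eq_or_lt with rfl | hp
  · simp
  · have hq' := hp.trans_le hq
    rw [← Real.log_inv, inv_div, mul_comm s, ← Real.rpow_def_of_pos (by positivity)]

theorem moment_true_true (P : PMF (𝒳 × 𝒴)) (s : ℝ) :
    moment (fun z => (P z).toReal) s True True = 1 := by
  rw [moment, ← sum_toReal P]
  refine Finset.sum_congr rfl fun z _ => ?_
  have : admissible True True z = {z} := by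
    ext z'; simp [admissible, Prod.ext_iff]
  rw [spread, this, Finset.sum_singleton]
  rcases eq_or_ne (P z).toReal 0 with h | h
  · simp [h]
  · rw [div_self h, Real.one_rpow, mul_one]

theorem moment_false_true (P : PMF (𝒳 × 𝒴)) (s : ℝ) :
    moment (fun z => (P z).toReal) s False True =
      ∑ z, (P z).toReal * Real.exp (s * condInfo P z) := by
  refine Finset.sum_congr rfl fun z _ => ?_
  have : ∑ z' ∈ admissible False True z, (P z').toReal = (P.map Prod.snd z.2).toReal := by
    classical
    rw [map_snd_toReal, admissible, Finset.sum_filter, Fintype.sum_prod_type]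
    simp
  rw [spread, this, mul_rpow_eq_mul_exp ENNReal.toReal_nonneg (toReal_le_map_snd P z)]
  rfl

theorem moment_true_false (P : PMF (𝒳 × 𝒴)) (s : ℝ) :
    moment (fun z => (P z).toReal) s True False =
      ∑ w, (swap P w).toReal * Real.exp (s * condInfo (swap P) w) := by
  rw [sum_swap]
  refine Finset.sum_congr rfl fun z _ => ?_
  have h : ∑ z' ∈ admissible True False z, (P z').toReal = (P.map Prod.fst z.1).toReal := by
    classical
    rw [map_fst_toReal, admissible, Finset.sum_filter, Fintype.sum_prod_type_right]
    simp
  have hle : (P z).toReal ≤ (P.map Prod.fst z.1).toReal := by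
    have := toReal_le_map_snd (swap P) z.swap
    rwa [swap_apply, swap_map_snd] at this
  rw [spread, h, mul_rpow_eq_mul_exp ENNReal.toReal_nonneg hle, condInfo, swap_apply,
    swap_map_snd]
  rfl

theorem toReal_le_one {α : Type*} (P : PMF α) (z : α) : (P z).toReal ≤ 1 :=
  ENNReal.toReal_le_of_le_ofReal zero_le_one (by simpa using P.coe_le_one z)

theorem moment_false_false (P : PMF (𝒳 × 𝒴)) (s : ℝ) :
    moment (fun z => (P z).toReal) s False False =
      ∑ z, (P z).toReal * Real.exp (s * -Real.log (P z).toReal) := by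
  refine Finset.sum_congr rfl fun z _ => ?_
  have h : ∑ z' ∈ admissible False False z, (P z').toReal = 1 := by
    rw [← sum_toReal P]
    congr 1
    ext z'; simp [admissible]
  rw [spread, h, mul_rpow_eq_mul_exp ENNReal.toReal_nonneg (toReal_le_one P z), div_one]

end Moments

/-! ### Summation over the first differences -/

/-- The three ranges are the blocks where both coordinates are right, where one is wrong, and where
both are treated as unconstrained. -/
theorem prod_two_thresholds {i j K : ℕ} (hij : i ≤ j) (hj : j ≤ K) (g : ℕ → ℝ) {u v : ℝ}
    (h₁ : ∀ l, l < i → g l = 1) (h₂ : ∀ l, i ≤ l → l < j → g l = u)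
    (h₃ : ∀ l, j ≤ l → g l = v) :
    ∏ l : Fin K, g l = u ^ (j - i) * v ^ (K - j) := by
  rw [← Finset.prod_range, ← Finset.prod_range_mul_prod_Ico g hj,
    ← Finset.prod_range_mul_prod_Ico g hij,
    Finset.prod_congr rfl (fun l hl => h₁ l (Finset.mem_range.1 hl)),
    Finset.prod_congr rfl (fun l hl => h₂ l (Finset.mem_Ico.1 hl).1 (Finset.mem_Ico.1 hl).2),
    Finset.prod_congr rfl (fun l hl => h₃ l (Finset.mem_Ico.1 hl).1)]
  simp

theorem collisionBound_le {N₁ N₂ K n : ℕ} {r₁ r₂ : ℝ} (h₁ : Real.exp (n * r₁) ≤ N₁)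
    (h₂ : Real.exp (n * r₂) ≤ N₂) (j : ℕ × ℕ) {s : ℝ} (hs : 0 ≤ s) :
    collisionBound N₁ N₂ K j ^ s ≤
      Real.exp (-(s * n * ((K - j.1 : ℕ) * r₁ + (K - j.2 : ℕ) * r₂))) := by
  have key : ∀ {N : ℕ} {r : ℝ} (m : ℕ), Real.exp (n * r) ≤ N →
      ((N : ℝ)⁻¹) ^ m ≤ Real.exp (m * -(n * r)) := by
    intro N r m h
    rw [Real.exp_nat_mul, Real.exp_neg]
    exact pow_le_pow_left₀ (by positivity) (inv_anti₀ (Real.exp_pos _) h) m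
  calc collisionBound N₁ N₂ K j ^ s
      ≤ (Real.exp ((K - j.1 : ℕ) * -(n * r₁)) * Real.exp ((K - j.2 : ℕ) * -(n * r₂))) ^ s := by
        refine Real.rpow_le_rpow (by unfold collisionBound; positivity) ?_ hs
        exact mul_le_mul (key _ h₁) (key _ h₂) (by positivity) (Real.exp_pos _).le
    _ = _ := by
        rw [← Real.exp_add, ← Real.exp_mul]
        congr 1
        ring

theorem geom_sum_le_two {r : ℝ} (h0 : 0 ≤ r) (h : r ≤ 1 / 2) (m : ℕ) :
    ∑ i ∈ Finset.range m, r ^ i ≤ 2 := by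
  have h1 := mul_neg_geom_sum r m
  have h2 : 0 ≤ r ^ m := pow_nonneg h0 m
  have h3 : 0 ≤ ∑ i ∈ Finset.range m, r ^ i := Finset.sum_nonneg fun i _ => pow_nonneg h0 i
  nlinarith

/-- The exponent is split as `x = (x - d) + d`. The first part uses `K - min j.1 j.2 ≥ T`; in the
second, twice this length is at least `(K - j.1) + (K - j.2)`, leaving a product of two geometric
series of ratio at most `1 / 2`, each with sum at most 2. -/
theorem sum_exp_first_difference_le {k T : ℕ} {x d : ℝ} (hd : 0 ≤ d) (hdx : d ≤ x)
    (hhalf : Real.exp (-(d / 2)) ≤ 1 / 2) :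
    ∑ j ∈ (Finset.range (k + T + 1) ×ˢ Finset.range (k + T + 1)).filter
        (fun j : ℕ × ℕ => min j.1 j.2 ≤ k), Real.exp (-(x * (k + T - min j.1 j.2 : ℕ)))
      ≤ 4 * Real.exp (-((x - d) * T)) := by
  set K := k + T with hK
  set r := Real.exp (-(d / 2)) with hr
  have hterm : ∀ j ∈ (Finset.range (K + 1) ×ˢ Finset.range (K + 1)).filter
      (fun j : ℕ × ℕ => min j.1 j.2 ≤ k), Real.exp (-(x * (K - min j.1 j.2 : ℕ))) ≤
        Real.exp (-((x - d) * T)) * (r ^ (K - j.1) * r ^ (K - j.2)) := by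
    intro j hj
    have hmin : min j.1 j.2 ≤ k := (Finset.mem_filter.1 hj).2
    have hT : (T : ℝ) ≤ (K - min j.1 j.2 : ℕ) := by
      exact_mod_cast (by omega : T ≤ K - min j.1 j.2)
    have h12 : ((K - j.1 : ℕ) : ℝ) + (K - j.2 : ℕ) ≤ 2 * (K - min j.1 j.2 : ℕ) := by
      exact_mod_cast (by omega : K - j.1 + (K - j.2) ≤ 2 * (K - min j.1 j.2))
    rw [hr, ← Real.exp_nat_mul, ← Real.exp_nat_mul, ← Real.exp_add, ← Real.exp_add]
    refine Real.exp_le_exp.2 ?_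
    have h3 := mul_le_mul_of_nonneg_left hT (sub_nonneg.2 hdx)
    have h4 := mul_le_mul_of_nonneg_left h12 hd
    linarith
  have hr0 : 0 ≤ r := (Real.exp_pos _).le
  have hsum : ∑ i ∈ Finset.range (K + 1), r ^ (K - i) ≤ 2 := by
    have := Finset.sum_range_reflect (fun i => r ^ i) (K + 1)
    simp only [add_tsub_cancel_right] at this
    rw [this]
    exact geom_sum_le_two hr0 hhalf _
  calc _ ≤ _ := Finset.sum_le_sum hterm
    _ ≤ ∑ j ∈ Finset.range (K + 1) ×ˢ Finset.range (K + 1),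
        Real.exp (-((x - d) * T)) * (r ^ (K - j.1) * r ^ (K - j.2)) :=
        Finset.sum_le_sum_of_subset_of_nonneg (Finset.filter_subset _ _)
          fun j _ _ => by positivity
    _ = Real.exp (-((x - d) * T)) * ((∑ i ∈ Finset.range (K + 1), r ^ (K - i)) *
          ∑ i ∈ Finset.range (K + 1), r ^ (K - i)) := by
        rw [← Finset.mul_sum, Finset.sum_mul_sum, Finset.sum_product]
    _ ≤ Real.exp (-((x - d) * T)) * (2 * 2) := by
        refine mul_le_mul_of_nonneg_left ?_ (Real.exp_pos _).le
        exact mul_le_mul hsum hsum (Finset.sum_nonneg fun i _ => by positivity) (by norm_num)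
    _ = _ := by ring

/-! ### Exponential error bound from the exponents of the error patterns -/

section ErrorExponent

variable {𝒳 𝒴 : Type*} [Fintype 𝒳] [Fintype 𝒴]

/-- The source `P` with rates `r` and `r'` (of the coordinate selected by `a b` and of both
coordinates) has exponent at least `x` per symbol for error patterns in which only the selected
coordinate is wrong in some blocks and both are wrong in others. -/
def HasExponent (P : PMF (𝒳 × 𝒴)) (a b : Prop) (r r' x : ℝ) : Prop :=
  ∀ l m : ℕ, ∃ s α β : ℝ, 0 ≤ s ∧ s ≤ 1 ∧ moment (fun z => (P z).toReal) s a b ≤ Real.exp α ∧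
    moment (fun z => (P z).toReal) s False False ≤ Real.exp β ∧
    (l + m) * x ≤ l * (s * r - α) + m * (s * r' - β)

theorem pow_mul_pow_le_exp {u v α β : ℝ} (hu0 : 0 ≤ u) (hv0 : 0 ≤ v) (hu : u ≤ Real.exp α)
    (hv : v ≤ Real.exp β) (n l m : ℕ) :
    (u ^ n) ^ l * (v ^ n) ^ m ≤ Real.exp (n * (l * α + m * β)) := by
  calc (u ^ n) ^ l * (v ^ n) ^ m ≤ (Real.exp α ^ n) ^ l * (Real.exp β ^ n) ^ m := by gcongr
    _ = _ := by
      rw [← Real.exp_nat_mul, ← Real.exp_nat_mul, ← Real.exp_nat_mul, ← Real.exp_nat_mul,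
        ← Real.exp_add]
      congr 1
      ring

variable [MeasurableSpace 𝒳] [MeasurableSpace 𝒴]
  [MeasurableSingletonClass 𝒳] [MeasurableSingletonClass 𝒴]

theorem errorProb_binningCode_le_exp [Nonempty (𝒳 × 𝒴)] (P : PMF (𝒳 × 𝒴)) {n N₁ N₂ T : ℕ}
    [NeZero N₁] [NeZero N₂] (hT : 1 ≤ T) {r₁ r₂ x d : ℝ} (h₁ : Real.exp (n * r₁) ≤ N₁)
    (h₂ : Real.exp (n * r₂) ≤ N₂) (hX : HasExponent P False True r₁ (r₁ + r₂) x)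
    (hY : HasExponent P True False r₂ (r₁ + r₂) x) (hd : 0 ≤ d) (hdx : d ≤ n * x)
    (hhalf : Real.exp (-(d / 2)) ≤ 1 / 2) (k : ℕ) :
    (binningCode (fun z => (P z).toReal) n N₁ N₂ T hT).errorProb P k
      ≤ 4 * Real.exp (-((n * x - d) * T)) := by
  set p : 𝒳 × 𝒴 → ℝ := fun z => (P z).toReal with hp_def
  have hp : ∀ z, 0 ≤ p z := fun z => ENNReal.toReal_nonneg
  set K := k + T with hK
  have hex : ∀ j : ℕ × ℕ, ∃ s, (0 ≤ s ∧ s ≤ 1) ∧ (j.1 ≤ K → j.2 ≤ K →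
      collisionBound N₁ N₂ K j ^ s * ∏ i : Fin K, moment p s (i < j.1) (i < j.2) ^ n
        ≤ Real.exp (-(n * x * (K - min j.1 j.2 : ℕ)))) := by
    rintro ⟨j₁, j₂⟩
    rcases le_total j₁ j₂ with hj | hj
    -- The first coordinate alone is wrong for `l = j₂ - j₁` blocks, then both for `m = K - j₂`.
    -- Hashing contributes `(K - j₁) * r₁ + (K - j₂) * r₂ = l * r₁ + m * (r₁ + r₂)`, and `l + m = K
    -- - min j₁ j₂`.
    · obtain ⟨s, α, β, hs0, hs1, hα, hβ, hx⟩ := hX (j₂ - j₁) (K - j₂)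
      refine ⟨s, ⟨hs0, hs1⟩, fun hj₁ hj₂ => ?_⟩
      simp only at hj₁ hj₂ ⊢
      rw [prod_two_thresholds hj hj₂ (fun l => moment p s (l < j₁) (l < j₂) ^ n)
        (u := moment p s False True ^ n) (v := moment p s False False ^ n)
        (fun l hl => by simp [hl, hl.trans_le hj, moment_true_true, hp_def])
        (fun l hl hl' => by simp [hl', not_lt.2 hl])
        (fun l hl => by simp [not_lt.2 hl, not_lt.2 (hj.trans hl)])]
      refine (mul_le_mul (collisionBound_le h₁ h₂ (j₁, j₂) hs0)
        (pow_mul_pow_le_exp (moment_nonneg hp _ _ _) (moment_nonneg hp _ _ _) hα hβ n _ _)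
        (mul_nonneg (pow_nonneg (pow_nonneg (moment_nonneg hp _ _ _) _) _)
          (pow_nonneg (pow_nonneg (moment_nonneg hp _ _ _) _) _)) (Real.exp_pos _).le).trans ?_
      rw [← Real.exp_add, min_eq_left hj]
      refine Real.exp_le_exp.2 ?_
      have hx' := mul_le_mul_of_nonneg_left hx (Nat.cast_nonneg (α := ℝ) n)
      simp only
      push_cast [hj₁, hj₂, hj] at hx' ⊢
      linarith
    · obtain ⟨s, α, β, hs0, hs1, hα, hβ, hx⟩ := hY (j₁ - j₂) (K - j₁)
      refine ⟨s, ⟨hs0, hs1⟩, fun hj₁ hj₂ => ?_⟩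
      simp only at hj₁ hj₂ ⊢
      rw [prod_two_thresholds hj hj₁ (fun l => moment p s (l < j₁) (l < j₂) ^ n)
        (u := moment p s True False ^ n) (v := moment p s False False ^ n)
        (fun l hl => by simp [hl, hl.trans_le hj, moment_true_true, hp_def])
        (fun l hl hl' => by simp [hl', not_lt.2 hl])
        (fun l hl => by simp [not_lt.2 hl, not_lt.2 (hj.trans hl)])]
      refine (mul_le_mul (collisionBound_le h₁ h₂ (j₁, j₂) hs0)
        (pow_mul_pow_le_exp (moment_nonneg hp _ _ _) (moment_nonneg hp _ _ _) hα hβ n _ _)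
        (mul_nonneg (pow_nonneg (pow_nonneg (moment_nonneg hp _ _ _) _) _)
          (pow_nonneg (pow_nonneg (moment_nonneg hp _ _ _) _) _)) (Real.exp_pos _).le).trans ?_
      rw [← Real.exp_add, min_eq_right hj]
      refine Real.exp_le_exp.2 ?_
      have hx' := mul_le_mul_of_nonneg_left hx (Nat.cast_nonneg (α := ℝ) n)
      simp only
      push_cast [hj₁, hj₂, hj] at hx' ⊢
      linarith
  choose σ hσ hσ' using hex
  refine (errorProb_binningCode_le P n N₁ N₂ T hT k σ hσ).trans
    ((Finset.sum_le_sum fun j hj => ?_).trans (sum_exp_first_difference_le hd hdx hhalf))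
  have hj := (Finset.mem_product.1 (Finset.mem_filter.1 hj).1)
  exact hσ' j (Nat.lt_succ_iff.1 (Finset.mem_range.1 hj.1))
    (Nat.lt_succ_iff.1 (Finset.mem_range.1 hj.2))

end ErrorExponent

/-! ### Properties of the entropies -/

section Entropy

variable {𝒳 𝒴 : Type*} [Fintype 𝒳] [Fintype 𝒴]

theorem sum_mul_comp_snd (P : PMF (𝒳 × 𝒴)) (f : 𝒴 → ℝ) :
    ∑ z, (P z).toReal * f z.2 = ∑ y, (P.map Prod.snd y).toReal * f y := by
  simp only [map_snd_toReal, Finset.sum_mul]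
  rw [Fintype.sum_prod_type_right]

theorem sum_mul_comp_fst (P : PMF (𝒳 × 𝒴)) (f : 𝒳 → ℝ) :
    ∑ z, (P z).toReal * f z.1 = ∑ x, (P.map Prod.fst x).toReal * f x := by
  simp only [map_fst_toReal, Finset.sum_mul]
  rw [Fintype.sum_prod_type]

theorem entropy_eq_condEntropy_add (P : PMF (𝒳 × 𝒴)) :
    entropy P = condEntropy P + entropy (P.map Prod.snd) := by
  rw [entropy, condEntropy, entropy, ← sum_mul_comp_snd P fun y =>
    -Real.log (P.map Prod.snd y).toReal, ← Finset.sum_add_distrib]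
  refine Finset.sum_congr rfl fun z _ => ?_
  rcases eq_or_ne (P z).toReal 0 with h | h
  · simp [h]
  · have hpos : 0 < (P z).toReal := lt_of_le_of_ne ENNReal.toReal_nonneg h.symm
    have hq := hpos.trans_le (toReal_le_map_snd P z)
    rw [condInfo, Real.log_div h hq.ne']
    ring

theorem condEntropy_nonneg (P : PMF (𝒳 × 𝒴)) : 0 ≤ condEntropy P := by
  refine Finset.sum_nonneg fun z _ => mul_nonneg ENNReal.toReal_nonneg ?_
  refine neg_nonneg.2 (Real.log_nonpos (by positivity) ?_)
  exact div_le_one_of_le₀ (toReal_le_map_snd P z) ENNReal.toReal_nonneg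

/-- Conditioning reduces entropy. -/
theorem condEntropy_le_entropy (P : PMF (𝒳 × 𝒴)) :
    condEntropy P ≤ entropy (P.map Prod.fst) := by
  -- This is `log u ≤ u - 1` at the ratio of the product law to the joint law; the corrections
  -- cancel in the sum because both laws have mass 1.
  have hterm : ∀ z : 𝒳 × 𝒴, (P z).toReal * condInfo P z ≤
      (P z).toReal * -Real.log (P.map Prod.fst z.1).toReal +
        ((P.map Prod.fst z.1).toReal * (P.map Prod.snd z.2).toReal - (P z).toReal) := by
    intro z
    rcases eq_or_ne (P z).toReal 0 with h | h
    · rw [h]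
      simp only [zero_mul, zero_add, sub_zero]
      positivity
    · have hpos : 0 < (P z).toReal := lt_of_le_of_ne ENNReal.toReal_nonneg h.symm
      have hq := hpos.trans_le (toReal_le_map_snd P z)
      have hq' : 0 < (P.map Prod.fst z.1).toReal := by
        have := toReal_le_map_snd (swap P) z.swap
        rw [swap_apply, swap_map_snd] at this
        exact hpos.trans_le this
      set a := (P.map Prod.fst z.1).toReal
      set b := (P.map Prod.snd z.2).toReal with hb
      have hlog := Real.log_le_sub_one_of_pos (x := a * b / (P z).toReal) (by positivity)
      rw [Real.log_div (by positivity) h, Real.log_mul hq'.ne' hq.ne'] at hlog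
      have := mul_le_mul_of_nonneg_left hlog hpos.le
      rw [mul_sub, mul_sub _ (a * b / _), mul_div_cancel₀ _ h] at this
      rw [condInfo, Real.log_div h hq.ne']
      linarith
  have hprod : ∑ z : 𝒳 × 𝒴, (P.map Prod.fst z.1).toReal * (P.map Prod.snd z.2).toReal = 1 := by
    rw [Fintype.sum_prod_type]
    simp only
    rw [← Finset.sum_mul_sum, sum_toReal, sum_toReal, one_mul]
  refine (Finset.sum_le_sum fun z _ => hterm z).trans_eq ?_
  rw [Finset.sum_add_distrib, Finset.sum_sub_distrib, hprod, sum_toReal, sub_self, add_zero,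
    sum_mul_comp_fst P fun x => -Real.log (P.map Prod.fst x).toReal, entropy]

theorem swap_swap {α β : Type*} (P : PMF (α × β)) : swap (swap P) = P := by
  rw [swap, swap, PMF.map_comp, Prod.swap_swap_eq, PMF.map_id]

theorem condEntropy_swap_le (P : PMF (𝒳 × 𝒴)) :
    condEntropy (swap P) ≤ entropy (P.map Prod.snd) := by
  have := condEntropy_le_entropy (swap P)
  rwa [← swap_map_snd (swap P), swap_swap] at this

end Entropy

/-! ### Quadratic exponents -/

/-- Every mixture of two Gaussian error exponents, with backoffs `τ` and `τ'` and variances `V`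
and `V'`, is at least `c`. The optimizing parameter stays bounded. -/
def MixtureExponentGE (τ V τ' V' c : ℝ) : Prop :=
  ∃ t₀, ∀ a b : ℝ, 0 ≤ a → 0 ≤ b → ∃ t, 0 ≤ t ∧ t ≤ t₀ ∧
    (a + b) * c ≤ a * (t * τ - t ^ 2 * V / 2) + b * (t * τ' - t ^ 2 * V' / 2)

/-- One `t` serves every mixture. This suffices when only one of the two constraints is tight, as
the other backoff can be taken large. -/
theorem mixtureExponentGE_of_common {τ V τ' V' c t : ℝ} (ht : 0 ≤ t)
    (h : c ≤ t * τ - t ^ 2 * V / 2) (h' : c ≤ t * τ' - t ^ 2 * V' / 2) :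
    MixtureExponentGE τ V τ' V' c := by
  refine ⟨t, fun a b ha hb => ⟨t, ht, le_rfl, ?_⟩⟩
  have := mul_le_mul_of_nonneg_left h ha
  have := mul_le_mul_of_nonneg_left h' hb
  linarith

/-- The exponent is a concave quadratic in `t`, maximal at `(a * τ + b * τ') / (a * V + b * V')`;
its maximum is the hypothesis at `γ = a / (a + b)`, scaled by `a + b`. -/
theorem mixtureExponentGE_of_forall {τ V τ' V' c : ℝ} (hτ : 0 < τ) (hV : 0 < V) (hτ' : 0 < τ')
    (hV' : 0 < V') (h : ∀ γ ∈ Set.Icc (0 : ℝ) 1,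
      c ≤ (γ * τ + (1 - γ) * τ') ^ 2 / (2 * (γ * V + (1 - γ) * V'))) :
    MixtureExponentGE τ V τ' V' c := by
  -- The maximizer is a mediant of `τ / V` and `τ' / V'`, so their sum bounds it for all weights.
  refine ⟨τ / V + τ' / V', fun a b ha hb => ?_⟩
  rcases (add_nonneg ha hb).eq_or_lt with hab | hab
  · have ha0 : a = 0 := by linarith
    have hb0 : b = 0 := by linarith
    exact ⟨0, le_rfl, by positivity, by simp [ha0, hb0]⟩
  have hW : 0 < a * V + b * V' := by
    rcases ha.eq_or_lt with rfl | ha'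
    · have : 0 < b := by linarith
      positivity
    · positivity
  refine ⟨(a * τ + b * τ') / (a * V + b * V'), by positivity, ?_, ?_⟩
  · rw [div_le_iff₀ hW]
    have h1 : (τ / V) * (a * V) = a * τ := by field_simp
    have h2 : (τ' / V') * (b * V') = b * τ' := by field_simp
    have h3 : 0 ≤ (τ / V) * (b * V') := by positivity
    have h4 : 0 ≤ (τ' / V') * (a * V) := by positivity
    linarith
  · have hγ := h (a / (a + b)) ⟨by positivity, by rw [div_le_one hab]; linarith⟩
    have h1 : 1 - a / (a + b) = b / (a + b) := by field_simp; ring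
    have h2 : (a / (a + b) * τ + (1 - a / (a + b)) * τ') ^ 2 /
        (2 * (a / (a + b) * V + (1 - a / (a + b)) * V')) =
        (a * τ + b * τ') ^ 2 / (2 * (a * V + b * V')) / (a + b) := by
      rw [h1]; field_simp
    rw [h2, le_div_iff₀ hab] at hγ
    have h3 : a * ((a * τ + b * τ') / (a * V + b * V') * τ -
        ((a * τ + b * τ') / (a * V + b * V')) ^ 2 * V / 2) +
        b * ((a * τ + b * τ') / (a * V + b * V') * τ' -
        ((a * τ + b * τ') / (a * V + b * V')) ^ 2 * V' / 2) =
        (a * τ + b * τ') ^ 2 / (2 * (a * V + b * V')) := by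
      field_simp
      ring
    rw [h3, mul_comm]
    exact hγ

/-! ### From Gaussian exponents to true exponents as the backoff vanishes -/

section Exponents

variable {𝒳 𝒴 : Type*} [Fintype 𝒳] [Fintype 𝒴]

/-- A mixture bound on the Gaussian exponents yields a bound on the true exponents when the
backoff tends to zero. -/
theorem eventually_hasExponent (P : PMF (𝒳 × 𝒴)) {a b : Prop} {α : Type*} [Fintype α]
    (Q : PMF α) (W : α → ℝ)
    (hW : ∀ s, moment (fun z => (P z).toReal) s a b =
      ∑ w, (Q w).toReal * Real.exp (s * W w))
    {μ V : ℝ} (hμ : ∑ w, (Q w).toReal * W w = μ) (hV : ∑ w, (Q w).toReal * (W w - μ) ^ 2 = V)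
    {ξ : ℕ → ℝ} (hξpos : ∀ n, 1 ≤ n → 0 < ξ n) (hξ0 : Tendsto ξ atTop (nhds 0))
    {r r' : ℕ → ℝ} {τ τ' c c' : ℝ} (hr : ∀ᶠ n in atTop, τ * ξ n ≤ r n - μ)
    (hr' : ∀ᶠ n in atTop, τ' * ξ n ≤ r' n - entropy P)
    (hmix : MixtureExponentGE τ V τ' (dispersion P) c) (hc : c' < c) :
    ∀ᶠ n in atTop, HasExponent P a b (r n) (r' n) (c' * ξ n ^ 2) := by
  obtain ⟨t₀, ht₀⟩ := hmix
  have ht₀' : 0 ≤ t₀ := by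
    obtain ⟨t, h0, h1, -⟩ := ht₀ 0 0 le_rfl le_rfl
    exact h0.trans h1
  -- The dispersion is inflated by `η`, chosen so that the loss `t ^ 2 * η / 2` stays within `c -
  -- c'` for all `t ≤ t₀`; the `+ 1` covers `t₀ = 0`.
  set η := 2 * (c - c') / (t₀ + 1) ^ 2 with hη
  have hηpos : 0 < η := by
    have : 0 < c - c' := sub_pos.2 hc
    positivity
  have hηt : ∀ t, 0 ≤ t → t ≤ t₀ → t ^ 2 * η / 2 ≤ c - c' := by
    intro t h0 h1
    have h2 : t ^ 2 ≤ (t₀ + 1) ^ 2 := pow_le_pow_left₀ h0 (by linarith) 2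
    calc t ^ 2 * η / 2 ≤ (t₀ + 1) ^ 2 * η / 2 := by gcongr
      _ = c - c' := by rw [hη]; field_simp
  obtain ⟨s₁, hs₁, hm₁⟩ := exists_mgf_le (fun w => (Q w).toReal)
    (fun w => ENNReal.toReal_nonneg) (sum_toReal Q) W hμ hV hηpos
  obtain ⟨s₂, hs₂, hm₂⟩ := exists_mgf_le (fun z => (P z).toReal)
    (fun w => ENNReal.toReal_nonneg) (sum_toReal P) (fun z => -Real.log (P z).toReal)
    (μ := entropy P) (V := dispersion P) rfl rfl hηpos
  have hsmall : ∀ δ : ℝ, 0 < δ → ∀ᶠ n in atTop, t₀ * ξ n ≤ δ := by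
    intro δ hδ
    have : Tendsto (fun n => t₀ * ξ n) atTop (nhds 0) := by simpa using hξ0.const_mul t₀
    exact (this.eventually (gt_mem_nhds hδ)).mono fun n h => h.le
  filter_upwards [hr, hr', hsmall s₁ hs₁, hsmall s₂ hs₂, hsmall 1 one_pos,
    eventually_ge_atTop 1] with n hrn hrn' h1 h2 h3 hn l m
  obtain ⟨t, ht0, htt₀, ht⟩ := ht₀ l m (Nat.cast_nonneg l) (Nat.cast_nonneg m)
  have hξ := hξpos n hn
  have hle : t * ξ n ≤ t₀ * ξ n := mul_le_mul_of_nonneg_right htt₀ hξ.le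
  have hs0 : 0 ≤ t * ξ n := by positivity
  -- Since `t ≤ t₀` whatever `l` and `m` are, `s = t * ξ n` is small uniformly over the error
  -- patterns.
  refine ⟨t * ξ n, _, _, hs0, hle.trans h3, (hW _).trans_le (hm₁ _ hs0 (hle.trans h1)),
    (moment_false_false P _).trans_le (hm₂ _ hs0 (hle.trans h2)), ?_⟩
  have hl : (0 : ℝ) ≤ l := Nat.cast_nonneg l
  have hm : (0 : ℝ) ≤ m := Nat.cast_nonneg m
  have key : ∀ {ρ κ h v : ℝ}, κ * ξ n ≤ ρ - h →
      ξ n ^ 2 * (t * κ - t ^ 2 * v / 2 - (c - c')) ≤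
        t * ξ n * ρ - (t * ξ n * h + (t * ξ n) ^ 2 * (v + η) / 2) := by
    intro ρ κ h v hρ
    have e1 := mul_le_mul_of_nonneg_left hρ hs0
    have e2 := mul_le_mul_of_nonneg_left (hηt t ht0 htt₀) (sq_nonneg (ξ n))
    linarith
  have k1 := mul_le_mul_of_nonneg_left (key (v := V) hrn) hl
  have k2 := mul_le_mul_of_nonneg_left (key (v := dispersion P) hrn') hm
  have k3 := mul_le_mul_of_nonneg_left ht (sq_nonneg (ξ n))
  linarith

end Exponents

/-! ### Achievability -/

/-- Eventually `log n ≤ n * ξ n ^ 2`. The divergence absorbs the constants of the error bound. -/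
theorem tendsto_mul_sq_atTop {ξ : ℕ → ℝ} (hξpos : ∀ n, 1 ≤ n → 0 < ξ n)
    (hξlog : Tendsto (fun n : ℕ => Real.log n / (n * ξ n ^ 2)) atTop (nhds 0)) :
    Tendsto (fun n : ℕ => (n : ℝ) * ξ n ^ 2) atTop atTop := by
  refine tendsto_atTop_mono' _ ?_ (Real.tendsto_log_atTop.comp tendsto_natCast_atTop_atTop)
  filter_upwards [hξlog.eventually (gt_mem_nhds one_pos), eventually_ge_atTop 1] with n h hn
  have hξ := hξpos n hn
  have hn' : (0 : ℝ) < n := by exact_mod_cast hn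
  rw [div_lt_one (by positivity)] at h
  exact h.le

theorem tendsto_mul_atTop {ξ : ℕ → ℝ} (hξpos : ∀ n, 1 ≤ n → 0 < ξ n)
    (hξ0 : Tendsto ξ atTop (nhds 0))
    (hξlog : Tendsto (fun n : ℕ => Real.log n / (n * ξ n ^ 2)) atTop (nhds 0)) :
    Tendsto (fun n : ℕ => (n : ℝ) * ξ n) atTop atTop := by
  refine tendsto_atTop_mono' _ ?_ (tendsto_mul_sq_atTop hξpos hξlog)
  filter_upwards [hξ0.eventually (gt_mem_nhds one_pos), eventually_ge_atTop 1] with n h hn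
  have hξ := hξpos n hn
  refine mul_le_mul_of_nonneg_left ?_ (Nat.cast_nonneg n)
  nlinarith

/-- Meant for a slack constraint: a constant gap `δ` eventually exceeds any multiple of `ξ n`. -/
theorem eventually_mul_le_add {ξ : ℕ → ℝ} (hξ0 : Tendsto ξ atTop (nhds 0)) {δ : ℝ} (hδ : 0 < δ)
    (τ κ : ℝ) : ∀ᶠ n in atTop, τ * ξ n ≤ δ + κ * ξ n := by
  have : Tendsto (fun n => (τ - κ) * ξ n) atTop (nhds 0) := by simpa using hξ0.const_mul (τ - κ)
  filter_upwards [this.eventually (gt_mem_nhds hδ)] with n hn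
  linarith

/-- The codebook size used at blocklength `n` and rate `r`. -/
def codebookSize (n : ℕ) (r : ℝ) : ℕ := ⌊Real.exp (n * r)⌋₊ + 1

instance (n : ℕ) (r : ℝ) : NeZero (codebookSize n r) := ⟨Nat.succ_ne_zero _⟩

theorem exp_le_codebookSize (n : ℕ) (r : ℝ) : Real.exp (n * r) ≤ codebookSize n r := by
  rw [codebookSize, Nat.cast_add_one]
  exact (Nat.lt_floor_add_one _).le

theorem log_codebookSize_le {n : ℕ} {r : ℝ} (hr : 0 ≤ r) :
    Real.log (codebookSize n r) ≤ n * r + Real.log 2 := by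
  rw [← Real.log_exp (n * r), ← Real.log_mul (Real.exp_pos _).ne' two_ne_zero]
  refine Real.log_le_log (by exact_mod_cast Nat.succ_pos _) ?_
  rw [codebookSize, Nat.cast_add_one]
  have h1 := Nat.floor_le (Real.exp_pos (n * r)).le
  have h2 : 1 ≤ Real.exp (n * r) := Real.one_le_exp (by positivity)
  linarith

theorem limsup_codebookSize_le {ξ : ℕ → ℝ} (hξpos : ∀ n, 1 ≤ n → 0 < ξ n)
    (hnξ : Tendsto (fun n : ℕ => (n : ℝ) * ξ n) atTop atTop) {R θ : ℝ}
    (hR : ∀ᶠ n in atTop, 0 ≤ R + θ * ξ n) :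
    limsup (fun n : ℕ => (((Real.log (codebookSize n (R + θ * ξ n)) - n * R) / (n * ξ n) : ℝ) :
      EReal)) atTop ≤ (θ : EReal) := by
  have hlim : Tendsto (fun n : ℕ => ((θ + Real.log 2 / (n * ξ n) : ℝ) : EReal)) atTop
      (nhds (θ : EReal)) := by
    refine (continuous_coe_real_ereal.tendsto θ).comp ?_
    simpa using (hnξ.const_div_atTop (Real.log 2)).const_add θ
  refine (limsup_le_limsup ?_).trans_eq hlim.limsup_eq
  filter_upwards [hR, eventually_ge_atTop 1] with n hn hn1
  have hpos : 0 < (n : ℝ) * ξ n := mul_pos (by exact_mod_cast hn1) (hξpos n hn1)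
  rw [EReal.coe_le_coe_iff, div_le_iff₀ hpos, add_mul, div_mul_cancel₀ _ hpos.ne']
  linarith [log_codebookSize_le (n := n) hn]

theorem Code.errorProb_le_one {𝒳 𝒴 : Type*} [MeasurableSpace 𝒳] [MeasurableSpace 𝒴] {n N₁ N₂ T : ℕ}
    (C : Code 𝒳 𝒴 n N₁ N₂ T) (P : PMF (𝒳 × 𝒴)) (k : ℕ) : C.errorProb P k ≤ 1 := by
  let _ := C.mRnd
  have := C.isProb
  exact measureReal_le_one

section Achievability

variable {𝒳 𝒴 : Type*} [Fintype 𝒳] [Fintype 𝒴] [MeasurableSpace 𝒳] [MeasurableSpace 𝒴]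
  [MeasurableSingletonClass 𝒳] [MeasurableSingletonClass 𝒴]

/-- If the backoffs from the three Slepian-Wolf constraints have Gaussian exponents at least `c`,
then the moderate deviations constant is at least `T * c`. -/
theorem le_nuStar (P : PMF (𝒳 × 𝒴)) {ξ : ℕ → ℝ} (hξpos : ∀ n, 1 ≤ n → 0 < ξ n)
    (hξ0 : Tendsto ξ atTop (nhds 0))
    (hξlog : Tendsto (fun n : ℕ => Real.log n / (n * ξ n ^ 2)) atTop (nhds 0))
    {T : ℕ} (hT : 1 ≤ T) {RX RY : ℝ} {θ : ℝ × ℝ} {τ₁ τ₂ τ c : ℝ} (hc : 0 < c)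
    (h₁ : ∀ᶠ n in atTop, τ₁ * ξ n ≤ RX + θ.1 * ξ n - condEntropy P)
    (h₂ : ∀ᶠ n in atTop, τ₂ * ξ n ≤ RY + θ.2 * ξ n - condEntropy (swap P))
    (h₁₂ : ∀ᶠ n in atTop, τ * ξ n ≤ RX + θ.1 * ξ n + (RY + θ.2 * ξ n) - entropy P)
    (hmix₁ : MixtureExponentGE τ₁ (condDispersion P) τ (dispersion P) c)
    (hmix₂ : MixtureExponentGE τ₂ (condDispersion (swap P)) τ (dispersion P) c)
    (hRX : ∀ᶠ n in atTop, 0 ≤ RX + θ.1 * ξ n) (hRY : ∀ᶠ n in atTop, 0 ≤ RY + θ.2 * ξ n) :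
    ((T * c : ℝ) : EReal) ≤ nuStar P ξ RX RY θ T := by
  classical
  have hne : Nonempty (𝒳 × 𝒴) := ⟨P.support_nonempty.some⟩
  have hTpos : (0 : ℝ) < T := by exact_mod_cast hT
  -- It suffices that every real `ν < T * c` is achievable.
  by_contra! hlt
  obtain ⟨ν, hν, hνc⟩ := EReal.lt_iff_exists_real_btwn.1 hlt
  rw [EReal.coe_lt_coe_iff] at hνc
  refine hν.not_ge (le_sSup ⟨ν, ?_, rfl⟩)
  -- The constants are arranged so that `c₁ < c' - d < c' < c`: `c'` is the exponent reached by the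
  -- code and `d` pays for the sum over patterns. The truncation at 0 keeps `c'` positive when `ν`
  -- is negative.
  set c₁ := max (ν / T) 0 with hc₁
  have hc₁c : c₁ < c := max_lt (by rw [div_lt_iff₀ hTpos]; linarith) hc
  have hc₁0 : 0 ≤ c₁ := le_max_right _ _
  have hνc₁ : ν ≤ T * c₁ := by
    have := le_max_left (ν / T) 0
    rw [div_le_iff₀ hTpos] at this
    linarith
  set c' := (c₁ + c) / 2 with hc'
  set d := (c - c₁) / 4 with hd
  have hdpos : 0 < d := by linarith
  have hgap : 0 < (c' - d) * T - ν := by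
    have : T * c₁ < T * (c' - d) := mul_lt_mul_of_pos_left (by linarith) hTpos
    linarith
  have hX := eventually_hasExponent P (a := False) (b := True) P (condInfo P)
    (moment_false_true P) (μ := condEntropy P) (V := condDispersion P) rfl rfl hξpos hξ0 h₁ h₁₂
    hmix₁ (by linarith : c' < c)
  have hY := eventually_hasExponent P (a := True) (b := False) (swap P) (condInfo (swap P))
    (moment_true_false P) (μ := condEntropy (swap P)) (V := condDispersion (swap P)) rfl rfl
    hξpos hξ0 h₂ h₁₂ hmix₂ (by linarith : c' < c)
  have hnξ2 := tendsto_mul_sq_atTop hξpos hξlog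
  set N₁ : ℕ → ℕ := fun n => codebookSize n (RX + θ.1 * ξ n) with hN₁
  set N₂ : ℕ → ℕ := fun n => codebookSize n (RY + θ.2 * ξ n) with hN₂
  have hgood : ∀ᶠ n : ℕ in atTop, ∃ C : Code 𝒳 𝒴 n (N₁ n) (N₂ n) T,
      ∀ k, C.errorProb P k ≤ Real.exp (-(ν * (n * ξ n ^ 2))) := by
    filter_upwards [hX, hY, hnξ2.eventually_ge_atTop (2 * Real.log 2 / d),
      hnξ2.eventually_ge_atTop (Real.log 4 / ((c' - d) * T - ν))] with n hXn hYn hn1 hn2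
    rw [div_le_iff₀ hdpos] at hn1
    rw [div_le_iff₀ hgap] at hn2
    have hx0 : 0 ≤ (n : ℝ) * ξ n ^ 2 := by positivity
    refine ⟨binningCode (fun z => (P z).toReal) n (N₁ n) (N₂ n) T hT, fun k => ?_⟩
    refine (errorProb_binningCode_le_exp P hT (exp_le_codebookSize n _)
      (exp_le_codebookSize n _) hXn hYn (d := n * ξ n ^ 2 * d) (by positivity) ?_ ?_ k).trans ?_
    · have := mul_le_mul_of_nonneg_left (by linarith : d ≤ c') hx0
      linarith
    · rw [one_div, ← Real.exp_log (two_pos (α := ℝ)), ← Real.exp_neg, Real.exp_log two_pos]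
      exact Real.exp_le_exp.2 (by linarith)
    · rw [← Real.exp_log (by norm_num : (0 : ℝ) < 4), ← Real.exp_add]
      exact Real.exp_le_exp.2 (by linarith)
  -- A code is required for every `n ≥ 1`; at the small `n` where the estimate is not available, the
  -- error bound 1 is used.
  refine ⟨N₁, N₂, fun n => if ∃ C : Code 𝒳 𝒴 n (N₁ n) (N₂ n) T,
      ∀ k, C.errorProb P k ≤ Real.exp (-(ν * (n * ξ n ^ 2)))
    then Real.exp (-(ν * (n * ξ n ^ 2))) else 1, fun n _ => ?_, ?_, ?_, ?_⟩
  · dsimp only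
    split_ifs with h
    · exact ⟨Real.exp_pos _, h⟩
    · exact ⟨one_pos, binningCode (fun z => (P z).toReal) n (N₁ n) (N₂ n) T hT,
        fun k => Code.errorProb_le_one _ P k⟩
  · exact limsup_codebookSize_le hξpos (tendsto_mul_atTop hξpos hξ0 hξlog) hRX
  · exact limsup_codebookSize_le hξpos (tendsto_mul_atTop hξpos hξ0 hξlog) hRY
  · refine le_liminf_of_le (by isBoundedDefault) ?_
    filter_upwards [hgood, hnξ2.eventually_gt_atTop 0] with n hn hpos
    rw [if_pos hn, Real.log_exp, neg_neg, mul_div_cancel_right₀ _ hpos.ne']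

end Achievability

end
end StreamingSW

/-! ### The three cases -/

open StreamingSW in
theorem theorem2 {𝒳 𝒴 : Type*} [Fintype 𝒳] [Fintype 𝒴]
    [MeasurableSpace 𝒳] [MeasurableSpace 𝒴]
    [MeasurableSingletonClass 𝒳] [MeasurableSingletonClass 𝒴]
    (P : PMF (𝒳 × 𝒴))
    (hVXY : 0 < dispersion P) (hVX : 0 < condDispersion P) (hVY : 0 < condDispersion (swap P))
    (ξ : ℕ → ℝ) (hξpos : ∀ n, 1 ≤ n → 0 < ξ n) (hξ0 : Tendsto ξ atTop (nhds 0))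
    (hξlog : Tendsto (fun n : ℕ => Real.log n / (n * ξ n ^ 2)) atTop (nhds 0))
    (T : ℕ) (hT : 1 ≤ T) (RX RY : ℝ) (θ : ℝ × ℝ) :
    -- Case (i)
    (RX = condEntropy P → entropy (P.map Prod.snd) < RY → 0 < θ.1 →
      ((T * θ.1 ^ 2 / (2 * condDispersion P) : ℝ) : EReal) ≤ nuStar P ξ RX RY θ T) ∧
    -- Case (ii)
    (RX = condEntropy P → RY = entropy (P.map Prod.snd) → condEntropy (swap P) < RY →
      0 < θ.1 → -θ.1 < θ.2 →
      ((T * min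
        (⨅ γ : Set.Icc (0 : ℝ) 1, (θ.1 + (1 - (γ : ℝ)) * θ.2) ^ 2 /
          (2 * ((γ : ℝ) * condDispersion P + (1 - (γ : ℝ)) * dispersion P)))
        ((θ.1 + θ.2) ^ 2 / (2 * dispersion P)) : ℝ) : EReal) ≤ nuStar P ξ RX RY θ T) ∧
    -- Case (iii)
    (RX + RY = entropy P → condEntropy P < RX → RX < entropy (P.map Prod.fst) →
      condEntropy (swap P) < RY → RY < entropy (P.map Prod.snd) → -θ.1 < θ.2 →
      ((T * (θ.1 + θ.2) ^ 2 / (2 * dispersion P) : ℝ) : EReal) ≤ nuStar P ξ RX RY θ T) := by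
  have hchain := entropy_eq_condEntropy_add P
  have hX0 := condEntropy_nonneg P
  have hY0 := condEntropy_nonneg (swap P)
  have hYle := condEntropy_swap_le P
  have hrate : ∀ {R : ℝ} (κ : ℝ), 0 < R → ∀ᶠ n in atTop, 0 ≤ R + κ * ξ n := fun κ hR =>
    (eventually_mul_le_add hξ0 hR 0 κ).mono fun n hn => by simpa using hn
  -- A backoff large enough for the exponent `c` at the parameter `t`.
  have hlarge : ∀ {t : ℝ} (c V : ℝ), 0 < t → ∃ τ, c ≤ t * τ - t ^ 2 * V / 2 := fun {t} c V ht =>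
    ⟨(c + t ^ 2 * V / 2) / t, by rw [mul_div_cancel₀ _ ht.ne']; linarith⟩
  -- The Gaussian exponent is attained at `t = τ / V`.
  have hopt : ∀ {τ V : ℝ}, 0 < V →
      τ ^ 2 / (2 * V) ≤ τ / V * τ - (τ / V) ^ 2 * V / 2 := fun {τ V} hV =>
    le_of_eq (by field_simp; ring)
  refine ⟨fun hRX hRY hθ => ?_, fun hRX hRY hdep hθ hθ' => ?_,
    fun hsum hRX _ hRY _ hθ => ?_⟩
  -- Only the constraint on `H(X|Y)` is tight, so `t` is its maximizer, and the two slack backoffs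
  -- are chosen to match.
  · have ht : 0 < θ.1 / condDispersion P := by positivity
    obtain ⟨τ, hτ⟩ := hlarge (θ.1 ^ 2 / (2 * condDispersion P)) (dispersion P) ht
    obtain ⟨τ₂, hτ₂⟩ :=
      hlarge (θ.1 ^ 2 / (2 * condDispersion P)) (condDispersion (swap P)) ht
    rw [mul_div_assoc]
    refine le_nuStar P hξpos hξ0 hξlog hT (by positivity) (τ₁ := θ.1) (τ₂ := τ₂) (τ := τ)
      (.of_forall fun n => by linarith) ?_ ?_
      (mixtureExponentGE_of_common ht.le (hopt hVX) hτ)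
      (mixtureExponentGE_of_common ht.le hτ₂ hτ) ?_ (hrate _ (by linarith))
    · filter_upwards [eventually_mul_le_add hξ0
        (by linarith : 0 < RY - condEntropy (swap P)) τ₂ θ.2] with n hn
      linarith
    · filter_upwards [eventually_mul_le_add hξ0
        (by linarith : 0 < RX + RY - entropy P) τ (θ.1 + θ.2)] with n hn
      linarith
    -- Only `H(X|Y) ≥ 0` is at hand here, not the strict positivity `hrate` asks for; `θ.1 > 0`
    -- makes up for it.
    · filter_upwards [eventually_ge_atTop 1] with n hn
      have := hξpos n hn
      rw [hRX]
      positivity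
  · have hθ12 : 0 < θ.1 + θ.2 := by linarith
    set m := min (⨅ γ : Set.Icc (0 : ℝ) 1, (θ.1 + (1 - (γ : ℝ)) * θ.2) ^ 2 /
      (2 * ((γ : ℝ) * condDispersion P + (1 - (γ : ℝ)) * dispersion P)))
      ((θ.1 + θ.2) ^ 2 / (2 * dispersion P)) with hm
    have hVγ : ∀ γ ∈ Set.Icc (0 : ℝ) 1,
        0 < γ * condDispersion P + (1 - γ) * dispersion P := by
      rintro γ ⟨h0, h1⟩
      rcases h0.eq_or_lt with rfl | h0'
      · simpa using hVXY
      · have := mul_pos h0' hVX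
        have := mul_nonneg (sub_nonneg.2 h1) hVXY.le
        linarith
    have hmγ : ∀ γ ∈ Set.Icc (0 : ℝ) 1, m ≤ (γ * θ.1 + (1 - γ) * (θ.1 + θ.2)) ^ 2 /
        (2 * (γ * condDispersion P + (1 - γ) * dispersion P)) := by
      intro γ hγ
      have hbdd : BddBelow (Set.range fun γ : Set.Icc (0 : ℝ) 1 =>
          (θ.1 + (1 - (γ : ℝ)) * θ.2) ^ 2 /
            (2 * ((γ : ℝ) * condDispersion P + (1 - (γ : ℝ)) * dispersion P))) := by
        refine ⟨0, ?_⟩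
        rintro _ ⟨γ, rfl⟩
        have := hVγ γ γ.2
        positivity
      refine (min_le_left _ _).trans ((ciInf_le hbdd ⟨γ, hγ⟩).trans_eq ?_)
      simp only
      -- The mixture of the backoffs `θ.1` and `θ.1 + θ.2` is `θ.1 + (1 - γ) * θ.2`.
      congr 2
      ring
    have hmpos : 0 < m := by
      refine lt_min ?_ (by positivity)
      -- Positivity at each `γ` does not suffice for an infimum; this bound is uniform in `γ`.
      have hlow : 0 < min θ.1 (θ.1 + θ.2) ^ 2 / (2 * (condDispersion P + dispersion P)) := by
        have := lt_min hθ hθ12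
        positivity
      refine hlow.trans_le (le_ciInf ?_)
      rintro ⟨γ, hγ⟩
      have hmin := lt_min hθ hθ12
      have h1 := mul_le_mul_of_nonneg_left (min_le_left θ.1 (θ.1 + θ.2)) hγ.1
      have h2 := mul_le_mul_of_nonneg_left (min_le_right θ.1 (θ.1 + θ.2)) (sub_nonneg.2 hγ.2)
      have h3 := mul_le_mul_of_nonneg_right hγ.2 hVX.le
      have h4 := mul_nonneg hγ.1 hVXY.le
      have := hVγ γ hγ
      refine div_le_div₀ (sq_nonneg _) (pow_le_pow_left₀ hmin.le ?_ 2) (by positivity) ?_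
      · linarith
      · simp only
        linarith
    -- When `Y` alone is wrong in the first differing blocks, the constraint on `H(Y|X)` is slack,
    -- so the joint maximizer serves and gives the second entry of the minimum.
    have ht : 0 < (θ.1 + θ.2) / dispersion P := by positivity
    obtain ⟨τ₂, hτ₂⟩ := hlarge m (condDispersion (swap P)) ht
    refine le_nuStar P hξpos hξ0 hξlog hT hmpos (τ₁ := θ.1) (τ₂ := τ₂) (τ := θ.1 + θ.2)
      (.of_forall fun n => by linarith) ?_ (.of_forall fun n => by linarith)
      (mixtureExponentGE_of_forall hθ hVX hθ12 hVXY hmγ)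
      (mixtureExponentGE_of_common ht.le hτ₂ ((min_le_right _ _).trans (hopt hVXY))) ?_
      (hrate _ (by linarith))
    · filter_upwards [eventually_mul_le_add hξ0
        (by linarith : 0 < RY - condEntropy (swap P)) τ₂ θ.2] with n hn
      linarith
    · filter_upwards [eventually_ge_atTop 1] with n hn
      have := hξpos n hn
      rw [hRX]
      positivity
  -- Only the sum-rate constraint is tight; both conditional backoffs are taken large at its
  -- maximizer.
  · have hθ12 : 0 < θ.1 + θ.2 := by linarith
    have ht : 0 < (θ.1 + θ.2) / dispersion P := by positivity
    obtain ⟨τ₁, hτ₁⟩ :=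
      hlarge ((θ.1 + θ.2) ^ 2 / (2 * dispersion P)) (condDispersion P) ht
    obtain ⟨τ₂, hτ₂⟩ :=
      hlarge ((θ.1 + θ.2) ^ 2 / (2 * dispersion P)) (condDispersion (swap P)) ht
    rw [mul_div_assoc]
    refine le_nuStar P hξpos hξ0 hξlog hT (by positivity) (τ₁ := τ₁) (τ₂ := τ₂)
      (τ := θ.1 + θ.2) ?_ ?_ (.of_forall fun n => by linarith)
      (mixtureExponentGE_of_common ht.le hτ₁ (hopt hVXY))
      (mixtureExponentGE_of_common ht.le hτ₂ (hopt hVXY)) (hrate _ (by linarith))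
      (hrate _ (by linarith))
    · filter_upwards [eventually_mul_le_add hξ0
        (by linarith : 0 < RX - condEntropy P) τ₁ θ.1] with n hn
      linarith
    · filter_upwards [eventually_mul_le_add hξ0
        (by linarith : 0 < RY - condEntropy (swap P)) τ₂ θ.2] with n hn
      linarith
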